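/- Let $N\ge 2$, let $c_0(N)=\left(\frac{N-2}{2}\right)^2$, let $\mu:\mathbb R^N\to\mathbb R$ be a density and write $d\mu=\mu(x)\,dx$ and $L^2_\mu=L^2(\mathbb R^N,d\mu)$ (all functions real-valued). Put $$U_\mu:=\frac14\left|\frac{\nabla\mu}{\mu}\right|^2-\frac12\frac{\Delta\mu}{\mu},\qquad c_{0,\mu}:=\liminf_{x\to0}\bigl(c_0(N)-|x|^2U_\mu(x)\bigr),\qquad U:=U_\mu-\frac1{|x|^2}\limsup_{x\to0}|x|^2U_\mu ,$$ where $\nabla\mu$ and $\Delta\mu$ are taken in the sense of distributions. These functions are defined $d\mu$-almost everywhere; accordingly the upper and lower limits are essential ones and the inequalities in (iii), (iv) below are meant $d\mu$-almost everywhere. Assume Hypothesis (H2): (i) $\mu\ge0$ a.e., $\mu^{1/2}\in H^1_{loc}(\mathbb R^N)$ and $\Delta\mu\in L^1_{loc}(\mathbb R^N)$; (ii) $c_{0,\mu}$ is finite; (iii) for every $R>0$ the function $U$ is bounded from above in $\mathbb R^N\setminus B_R$, where $B_R$ is the open ball of radius $R$ centred at $0$; (iv) there is $R_0>0$ such that $|x|^2U(x)\le\frac14\frac1{|\log|x||^2}$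 for $x\in B_{R_0}$. Let $H^1_\mu$ be the weighted Sobolev space of all $\varphi\in L^2_\mu$ which have a weak gradient $\nabla\varphi\in (L^2_\mu)^N$, in the sense that $$\int\eta\,\nabla\varphi\,d\mu=-\int\varphi\,\nabla\eta\,d\mu-\int\varphi\,\eta\,\frac{\nabla\mu}{\mu}\,d\mu\qquad\text{for all }\eta\in C_c^\infty(\mathbb R^N).$$ Then there is a constant $C_\mu\in\mathbb R$, depending only on $\mu$ (and $N$), such that for every $\varphi\in H^1_\mu$ $$c_{0,\mu}\int_{\mathbb R^N}\frac{\varphi^2}{|x|^2}\,d\mu\le\int_{\mathbb R^N}|\nabla\varphi|^2\,d\mu+C_\mu\int_{\mathbb R^N}\varphi^2\,d\mu ;$$ in particular, if $c_{0,\mu}>0$, then $\varphi^2/|x|^2$ is $d\mu$-integrable. -/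

import Mathlib

open MeasureTheory Filter Topology
open scoped ContDiff

namespace WeightedHardy

/-- Euclidean space `ℝ^N` (with Euclidean norm and Lebesgue measure `volume`). -/
abbrev Rn (N : ℕ) : Type := EuclideanSpace ℝ (Fin N)

/-- `η ∈ C_c^∞(ℝ^N)`. -/
def IsTest {N : ℕ} (η : Rn N → ℝ) : Prop :=
  ContDiff ℝ ∞ η ∧ HasCompactSupport η

/-- `G` is the weak (distributional) gradient of the locally integrable function `f`:
`∫ f ∇η dx = - ∫ η G dx` for all test functions `η`. -/
def HasWeakGradient {N : ℕ} (f : Rn N → ℝ) (G : Rn N → Rn N) : Prop :=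
  LocallyIntegrable f ∧ LocallyIntegrable G ∧
    ∀ η : Rn N → ℝ, IsTest η → ∫ x, f x • gradient η x = - ∫ x, η x • G x

/-- `D` is the distributional Laplacian of the locally integrable function `f`, and
`D ∈ L^1_loc`: `∫ f Δη dx = ∫ η D dx` for all test functions `η`. -/
def HasWeakLaplacian {N : ℕ} (f D : Rn N → ℝ) : Prop :=
  LocallyIntegrable f ∧ LocallyIntegrable D ∧
    ∀ η : Rn N → ℝ, IsTest η → ∫ x, f x * Laplacian.laplacian η x = ∫ x, η x * D x

/-- `f ∈ H^1_loc(ℝ^N)`: `f` and its weak gradient are square integrable on compact sets. -/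
def MemH1Loc {N : ℕ} (f : Rn N → ℝ) : Prop :=
  ∃ G : Rn N → Rn N, HasWeakGradient f G ∧
    ∀ K : Set (Rn N), IsCompact K →
      MemLp f 2 (volume.restrict K) ∧ MemLp G 2 (volume.restrict K)

open Classical in
/-- The weak gradient `∇f` (unique up to null sets); `0` if there is none. -/
noncomputable def weakGradient {N : ℕ} (f : Rn N → ℝ) : Rn N → Rn N :=
  if h : ∃ G, HasWeakGradient f G then h.choose else 0

open Classical in
/-- The distributional Laplacian `Δf` as an `L^1_loc` function (unique up to null sets);
`0` if there is none. -/
noncomputable def weakLaplacian {N : ℕ} (f : Rn N → ℝ) : Rn N → ℝ :=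
  if h : ∃ D, HasWeakLaplacian f D then h.choose else 0

/-- The measure `dμ = μ(x) dx` with density `μ ≥ 0`. -/
noncomputable def dens {N : ℕ} (μ : Rn N → ℝ) : Measure (Rn N) :=
  volume.withDensity fun x => ENNReal.ofReal (μ x)

/-- The logarithmic gradient `∇μ / μ`. It matters only where `μ > 0`, i.e. `dμ`-a.e. -/
noncomputable def logGradient {N : ℕ} (μ : Rn N → ℝ) (x : Rn N) : Rn N :=
  (μ x)⁻¹ • weakGradient μ x

/-- The Hardy constant `c₀(N) = ((N - 2) / 2)^2`. -/
noncomputable def c₀ (N : ℕ) : ℝ := (((N : ℝ) - 2) / 2) ^ 2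

/-- `U_μ = (1/4) |∇μ/μ|^2 - (1/2) Δμ/μ`, a function defined `dμ`-a.e. -/
noncomputable def Uμ {N : ℕ} (μ : Rn N → ℝ) (x : Rn N) : ℝ :=
  1 / 4 * ‖logGradient μ x‖ ^ 2 - 1 / 2 * (weakLaplacian μ x / μ x)

/-- The filter "`x → 0`, `x ≠ 0`, up to `dμ`-null sets": upper and lower limits along it are the
essential ones, as is proper for functions that are defined only `dμ`-a.e. -/
noncomputable def nearZero {N : ℕ} (μ : Rn N → ℝ) : Filter (Rn N) :=
  𝓝[≠] 0 ⊓ ae (dens μ)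

/-- `c_{0,μ} = liminf_{x → 0} (c₀(N) - |x|^2 U_μ(x))`, as an extended real number. -/
noncomputable def c₀μ {N : ℕ} (μ : Rn N → ℝ) : EReal :=
  liminf (fun x => ((c₀ N - ‖x‖ ^ 2 * Uμ μ x : ℝ) : EReal)) (nearZero μ)

/-- `limsup_{x → 0} |x|^2 U_μ(x)`, as an extended real number. -/
noncomputable def limsupU {N : ℕ} (μ : Rn N → ℝ) : EReal :=
  limsup (fun x => ((‖x‖ ^ 2 * Uμ μ x : ℝ) : EReal)) (nearZero μ)

/-- `U = U_μ - |x|^{-2} limsup_{x → 0} |x|^2 U_μ`. (The upper limit is finite as soon as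
`c_{0,μ}` is.) -/
noncomputable def U {N : ℕ} (μ : Rn N → ℝ) (x : Rn N) : ℝ :=
  Uμ μ x - 1 / ‖x‖ ^ 2 * (limsupU μ).toReal

/-- Hypothesis (H2) on the density `μ`. -/
structure HypH2 {N : ℕ} (μ : Rn N → ℝ) : Prop where
  nonneg : ∀ᵐ x, 0 ≤ μ x
  sqrt_mem : MemH1Loc fun x => √(μ x)
  laplacian : ∃ D, HasWeakLaplacian μ D
  finite : c₀μ μ ≠ ⊥ ∧ c₀μ μ ≠ ⊤
  bounded : ∀ R : ℝ, 0 < R → ∃ K : ℝ, ∀ᵐ x ∂(dens μ), R ≤ ‖x‖ → U μ x ≤ K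
  log_bound : ∃ R₀ : ℝ, 0 < R₀ ∧ ∀ᵐ x ∂(dens μ), ‖x‖ < R₀ →
    ‖x‖ ^ 2 * U μ x ≤ 1 / 4 * (1 / |Real.log ‖x‖| ^ 2)

/-- `φ` belongs to the weighted Sobolev space `H^1_μ` and `F` is its weak gradient `∇φ`:
`φ, F ∈ L^2_μ` and `∫ η F dμ = - ∫ φ ∇η dμ - ∫ φ η (∇μ/μ) dμ` for all test functions `η`.
This is integration by parts against `dμ`; it is meaningful for every `φ ∈ L^2_μ` when
`μ^{1/2} ∈ H^1_loc`, also where `μ` vanishes and `φ` need not be locally integrable. -/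
structure MemH1μ {N : ℕ} (μ φ : Rn N → ℝ) (F : Rn N → Rn N) : Prop where
  memLp : MemLp φ 2 (dens μ)
  memLp_grad : MemLp F 2 (dens μ)
  weak : ∀ η : Rn N → ℝ, IsTest η →
    ∫ x, η x • F x ∂(dens μ) =
      - (∫ x, φ x • gradient η x ∂(dens μ)) - ∫ x, (φ x * η x) • logGradient μ x ∂(dens μ)

end WeightedHardy

/-! The engine is a ground state inequality. For a smooth density `m > 0` with gradient `B`, a
compactly supported `f` and a vector field `V`, expand `0 ≤ ∫ |∇f + f (B / (2m) - V)|² m`. The cross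
terms are `∇(f²) · B` and `∇(f² m) · V`; integrating them by parts gives `∫ |∇f|² m + ∫ f² U_m m ≥ -
∫ f² m (|V|² + div V)`, where `U_m = |B/m|² / 4 - div B / (2m)`.

Take for `V` the logarithmic gradient of `ψ = |x| ^ (-(N-2)/2) * |log |x|| ^ (1/2)`. Near the origin
`-(|V|² + div V) = -Δψ/ψ = c₀(N) / |x|² + 1 / (4 |x|² log² |x|)`. The second term is exactly what
(H2)(iv) allows `U` to use up, and `c_{0,μ}` is at most `c₀(N)` minus the upper limit of `|x|² U_μ`.
So `c_{0,μ} / |x|²` lies below the Hardy potential minus `U_μ` near `0`; away from `0` both are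
bounded on the relevant side and a constant `C` absorbs the difference (`exists_potential_bound`).

The work lies in reaching rough data: `μ` may vanish, and `φ` need not be locally integrable. The
proof therefore handles the product `w = φ μ`, whose weak gradient is `A = μ F + φ ∇μ`, and recovers
`φ` as `w / μ`. Numerator and denominator are mollified separately, with `e > 0` added to the
denominator. The Cauchy-Schwarz bounds `|A|² ≤ m h` and `|B|² ≤ m b` survive mollification
(`norm_moll_sq_le`), so the integrands are dominated by mollified `L¹_loc` functions
(`abs_gsIntegrand_le`), which converge in `L¹` on bounded sets. The limits are taken in this order:
mollification, `e → 0`, removal of the regularization `d` in `|x|² + d` (`hardy_cutoff`), and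
finally removal of the truncation of `φ` together with the spatial cutoff (`hardy_of_potential_le`).
The last two use Fatou's lemma. If `c_{0,μ} ≤ 0` the inequality is trivial with `C = 0`. -/

namespace WeightedHardy

/-! ### Limit theorems for integrals. -/

section Limits

/-- A variant of dominated convergence in which the dominating functions converge in `L¹`. -/
theorem tendsto_integral_of_dominated_L1 {α E : Type*} [MeasurableSpace α] {ν : Measure α}
    [NormedAddCommGroup E] [NormedSpace ℝ E] {f : ℕ → α → E} {f₀ : α → E} {g : ℕ → α → ℝ}
    {g₀ : α → ℝ} (hf : ∀ n, AEStronglyMeasurable (f n) ν) (hg : ∀ n, Integrable (g n) ν)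
    (hg₀ : Integrable g₀ ν) (hle : ∀ n, ∀ᵐ x ∂ν, ‖f n x‖ ≤ g n x)
    (hflim : ∀ᵐ x ∂ν, Tendsto (fun n => f n x) atTop (𝓝 (f₀ x)))
    (hglim : ∀ᵐ x ∂ν, Tendsto (fun n => g n x) atTop (𝓝 (g₀ x)))
    (hL1 : Tendsto (fun n => ∫ x, |g n x - g₀ x| ∂ν) atTop (𝓝 0)) :
    Integrable f₀ ν ∧ Tendsto (fun n => ∫ x, f n x ∂ν) atTop (𝓝 (∫ x, f₀ x ∂ν)) := by
  have hf₀m : AEStronglyMeasurable f₀ ν := aestronglyMeasurable_of_tendsto_ae atTop hf hflim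
  have hle₀ : ∀ᵐ x ∂ν, ‖f₀ x‖ ≤ g₀ x := by
    filter_upwards [ae_all_iff.2 hle, hflim, hglim] with x h1 h2 h3
    exact le_of_tendsto_of_tendsto' h2.norm h3 h1
  have hf₀ : Integrable f₀ ν := hg₀.mono' hf₀m hle₀
  have hfi : ∀ n, Integrable (f n) ν := fun n => (hg n).mono' (hf n) (hle n)
  refine ⟨hf₀, ?_⟩
  -- Since `‖f n - f₀‖ ≤ g n + g₀ ≤ 2 g₀ + |g n - g₀|`, the difference is at most `min ‖f n - f₀‖ (2
  -- g₀) + |g n - g₀|`. The minimum has a fixed integrable majorant.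
  have hmin : Tendsto (fun n => ∫ x, min ‖f n x - f₀ x‖ (2 * g₀ x) ∂ν) atTop
      (𝓝 (∫ _, (0 : ℝ) ∂ν)) := by
    refine tendsto_integral_of_dominated_convergence (fun x => 2 * g₀ x) (fun n => ?_)
      (hg₀.const_mul 2) (fun n => ?_) ?_
    · exact (((hf n).sub hf₀m).norm.aemeasurable.min
        (hg₀.aestronglyMeasurable.aemeasurable.const_mul 2)).aestronglyMeasurable
    · filter_upwards [hle₀] with x hx
      have h0 : 0 ≤ g₀ x := (norm_nonneg _).trans hx
      rw [Real.norm_of_nonneg (le_min (norm_nonneg _) (by positivity))]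
      exact min_le_right _ _
    · filter_upwards [hle₀, hflim] with x hx h2
      have h0 : 0 ≤ g₀ x := (norm_nonneg _).trans hx
      have h3 : Tendsto (fun n => ‖f n x - f₀ x‖) atTop (𝓝 0) :=
        tendsto_iff_norm_sub_tendsto_zero.1 h2
      exact squeeze_zero (fun n => le_min (norm_nonneg _) (by positivity))
        (fun n => min_le_left _ _) h3
  have hsum : Tendsto (fun n => ∫ x, min ‖f n x - f₀ x‖ (2 * g₀ x) ∂ν
      + ∫ x, |g n x - g₀ x| ∂ν) atTop (𝓝 0) := by
    simpa using hmin.add hL1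
  rw [tendsto_iff_norm_sub_tendsto_zero]
  refine squeeze_zero (fun _ => norm_nonneg _) (fun n => ?_) hsum
  have hmi : Integrable (fun x => min ‖f n x - f₀ x‖ (2 * g₀ x)) ν :=
    ((hfi n).sub hf₀).norm.inf (hg₀.const_mul 2)
  have hgi : Integrable (fun x => |g n x - g₀ x|) ν := ((hg n).sub hg₀).abs
  rw [← integral_sub (hfi n) hf₀, ← integral_add hmi hgi]
  refine (norm_integral_le_integral_norm _).trans ?_
  refine integral_mono_ae ((hfi n).sub hf₀).norm (hmi.add hgi) ?_
  filter_upwards [hle n, hle₀] with x h1 h2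
  have h3 := norm_sub_le (f n x) (f₀ x)
  have h4 := le_abs_self (g n x - g₀ x)
  have h5 := abs_nonneg (g n x - g₀ x)
  rcases min_cases ‖f n x - f₀ x‖ (2 * g₀ x) with ⟨h, _⟩ | ⟨h, _⟩ <;> rw [h] <;> linarith

/-- Scheffé's lemma. -/
theorem tendsto_integral_abs_sub_of_tendsto_integral {α : Type*} [MeasurableSpace α]
    {ν : Measure α} {g : ℕ → α → ℝ} {g₀ : α → ℝ} (hg : ∀ n, Integrable (g n) ν)
    (hg₀ : Integrable g₀ ν) (hnn : ∀ n, ∀ᵐ x ∂ν, 0 ≤ g n x)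
    (hlim : ∀ᵐ x ∂ν, Tendsto (fun n => g n x) atTop (𝓝 (g₀ x)))
    (hint : Tendsto (fun n => ∫ x, g n x ∂ν) atTop (𝓝 (∫ x, g₀ x ∂ν))) :
    Tendsto (fun n => ∫ x, |g n x - g₀ x| ∂ν) atTop (𝓝 0) := by
  have hnn₀ : ∀ᵐ x ∂ν, 0 ≤ g₀ x := by
    filter_upwards [ae_all_iff.2 hnn, hlim] with x h1 h2
    exact ge_of_tendsto' h2 h1
  -- The identity `|a - b| = a + b - 2 min a b` reduces the claim to the minimum, which `g₀`
  -- dominates.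
  have hmin : Tendsto (fun n => ∫ x, min (g n x) (g₀ x) ∂ν) atTop (𝓝 (∫ x, g₀ x ∂ν)) := by
    refine tendsto_integral_of_dominated_convergence g₀ (fun n => ?_) hg₀ (fun n => ?_) ?_
    · exact ((hg n).inf hg₀).aestronglyMeasurable
    · filter_upwards [hnn n, hnn₀] with x h1 h2
      rw [Real.norm_of_nonneg (le_min h1 h2)]
      exact min_le_right _ _
    · filter_upwards [hlim] with x h
      simpa using h.min (tendsto_const_nhds (x := g₀ x))
  have h := (hint.add (tendsto_const_nhds (x := ∫ x, g₀ x ∂ν))).sub (hmin.const_mul 2)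
  have h0 : ∫ x, g₀ x ∂ν + ∫ x, g₀ x ∂ν - 2 * ∫ x, g₀ x ∂ν = 0 := by ring
  rw [h0] at h
  refine h.congr fun n => ?_
  have hmi : Integrable (fun x => min (g n x) (g₀ x)) ν := (hg n).inf hg₀
  rw [← integral_const_mul, ← integral_add (hg n) hg₀,
    ← integral_sub (f := fun x => g n x + g₀ x) ((hg n).add hg₀) (hmi.const_mul 2)]
  refine integral_congr_ae (Eventually.of_forall fun x => ?_)
  dsimp only
  rcases le_total (g n x) (g₀ x) with h | h
  · rw [min_eq_left h, abs_of_nonpos (by linarith)]; ring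
  · rw [min_eq_right h, abs_of_nonneg (by linarith)]; ring

/-- Fatou's lemma for real-valued nonnegative functions with converging integral bounds. -/
theorem integrable_and_integral_le_of_tendsto {α : Type*} [MeasurableSpace α] {ν : Measure α}
    {f : ℕ → α → ℝ} {f₀ : α → ℝ} {M : ℕ → ℝ} {M₀ : ℝ} (hf : ∀ n, Integrable (f n) ν)
    (hnn : ∀ n, ∀ᵐ x ∂ν, 0 ≤ f n x)
    (hlim : ∀ᵐ x ∂ν, Tendsto (fun n => f n x) atTop (𝓝 (f₀ x)))
    (hle : ∀ n, ∫ x, f n x ∂ν ≤ M n) (hM : Tendsto M atTop (𝓝 M₀)) :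
    Integrable f₀ ν ∧ ∫ x, f₀ x ∂ν ≤ M₀ := by
  have hm : AEStronglyMeasurable f₀ ν :=
    aestronglyMeasurable_of_tendsto_ae atTop (fun n => (hf n).aestronglyMeasurable) hlim
  have hnn₀ : ∀ᵐ x ∂ν, 0 ≤ f₀ x := by
    filter_upwards [ae_all_iff.2 hnn, hlim] with x h1 h2
    exact ge_of_tendsto' h2 h1
  have hM₀ : 0 ≤ M₀ := ge_of_tendsto' hM fun n => (integral_nonneg_of_ae (hnn n)).trans (hle n)
  have key : ∫⁻ x, ENNReal.ofReal (f₀ x) ∂ν ≤ ENNReal.ofReal M₀ := by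
    calc ∫⁻ x, ENNReal.ofReal (f₀ x) ∂ν
        = ∫⁻ x, liminf (fun n => ENNReal.ofReal (f n x)) atTop ∂ν := by
          refine lintegral_congr_ae ?_
          filter_upwards [hlim] with x hx
          exact ((ENNReal.tendsto_ofReal hx).liminf_eq).symm
      _ ≤ liminf (fun n => ∫⁻ x, ENNReal.ofReal (f n x) ∂ν) atTop :=
          lintegral_liminf_le' fun n => (hf n).aestronglyMeasurable.aemeasurable.ennreal_ofReal
      _ ≤ liminf (fun n => ENNReal.ofReal (M n)) atTop := by
          refine liminf_le_liminf (Eventually.of_forall fun n => ?_)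
          rw [← ofReal_integral_eq_lintegral_ofReal (hf n) (hnn n)]
          exact ENNReal.ofReal_le_ofReal (hle n)
      _ = ENNReal.ofReal M₀ := (ENNReal.tendsto_ofReal hM).liminf_eq
  refine ⟨⟨hm, ?_⟩, ?_⟩
  · rw [hasFiniteIntegral_iff_ofReal hnn₀]
    exact key.trans_lt ENNReal.ofReal_lt_top
  · rw [integral_eq_lintegral_of_nonneg_ae hnn₀ hm]
    exact ENNReal.toReal_le_of_le_ofReal hM₀ key

end Limits

/-! ### Closure properties of local integrability. -/

section LocallyIntegrable

variable {N : ℕ} {E : Type*} [NormedAddCommGroup E]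

theorem locallyIntegrable_of_norm_le {F : Type*} [NormedAddCommGroup F] {f : Rn N → E}
    {g : Rn N → F} (hg : LocallyIntegrable g) (hf : AEStronglyMeasurable f)
    (h : ∀ᵐ x, ‖f x‖ ≤ ‖g x‖) : LocallyIntegrable f :=
  hg.mono hf h

theorem locallyIntegrable_norm {f : Rn N → E} (hf : LocallyIntegrable f) :
    LocallyIntegrable fun x => ‖f x‖ :=
  hf.mono hf.aestronglyMeasurable.norm (Eventually.of_forall fun x => by simp)

theorem locallyIntegrable_const_mul {f : Rn N → ℝ} (c : ℝ) (hf : LocallyIntegrable f) :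
    LocallyIntegrable fun x => c * f x :=
  hf.smul c

theorem locallyIntegrable_add {f g : Rn N → E} (hf : LocallyIntegrable f)
    (hg : LocallyIntegrable g) : LocallyIntegrable fun x => f x + g x :=
  hf.add hg

end LocallyIntegrable

/-! ### Mollification and its domination properties. -/

section Mollifier

variable {N : ℕ} {E : Type*} [NormedAddCommGroup E] [NormedSpace ℝ E]

/-- Smooth bump functions with radius tending to zero. -/
noncomputable def mollBump (N n : ℕ) : ContDiffBump (0 : Rn N) where
  rIn := 1 / (2 * ((n : ℝ) + 1))
  rOut := 1 / ((n : ℝ) + 1)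
  rIn_pos := by positivity
  rIn_lt_rOut := by
    apply one_div_lt_one_div_of_lt <;> linarith [(Nat.cast_nonneg n : (0 : ℝ) ≤ n)]

/-- The mollifying kernel. -/
noncomputable def mollKer (N n : ℕ) : Rn N → ℝ := (mollBump N n).normed volume

/-- Mollification of a locally integrable function. -/
noncomputable def moll (n : ℕ) (f : Rn N → E) (x : Rn N) : E :=
  ∫ t, mollKer N n (x - t) • f t

theorem mollKer_contDiff (n : ℕ) : ContDiff ℝ ∞ (mollKer N n) := (mollBump N n).contDiff_normed

theorem mollKer_nonneg (n : ℕ) (x : Rn N) : 0 ≤ mollKer N n x := (mollBump N n).nonneg_normed x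

theorem mollKer_hasCompactSupport (n : ℕ) : HasCompactSupport (mollKer N n) :=
  (mollBump N n).hasCompactSupport_normed

theorem mollKer_eq_zero {n : ℕ} {x : Rn N} (hx : 1 ≤ ‖x‖) : mollKer N n x = 0 := by
  have h : x ∉ Function.support (mollKer N n) := by
    rw [mollKer, (mollBump N n).support_normed_eq, Metric.mem_ball, dist_zero_right, not_lt]
    refine le_trans ?_ hx
    change 1 / ((n : ℝ) + 1) ≤ 1
    rw [div_le_one (by positivity)]
    linarith [(Nat.cast_nonneg n : (0 : ℝ) ≤ n)]
  simpa using h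

theorem integral_mollKer (n : ℕ) : ∫ x, mollKer N n x = 1 := (mollBump N n).integral_normed

theorem moll_eq_convolution (n : ℕ) (f : Rn N → E) :
    moll n f = convolution (mollKer N n) f (ContinuousLinearMap.lsmul ℝ ℝ) volume := by
  funext x
  rw [convolution_eq_swap]
  rfl

theorem isTest_mollKer_sub (n : ℕ) (x : Rn N) : IsTest fun t => mollKer N n (x - t) :=
  ⟨(mollKer_contDiff n).comp (contDiff_const.sub contDiff_id),
    (mollKer_hasCompactSupport n).comp_homeomorph (Homeomorph.subLeft x)⟩

theorem integrable_mollKer_smul (n : ℕ) {f : Rn N → E} (hf : LocallyIntegrable f) (x : Rn N) :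
    Integrable fun t => mollKer N n (x - t) • f t :=
  hf.integrable_smul_left_of_hasCompactSupport (isTest_mollKer_sub n x).1.continuous
    (isTest_mollKer_sub n x).2

theorem moll_contDiff (n : ℕ) {f : Rn N → E} (hf : LocallyIntegrable f) :
    ContDiff ℝ ∞ (moll n f) := by
  rw [moll_eq_convolution]
  exact (mollKer_hasCompactSupport n).contDiff_convolution_left _ (n := ⊤) (mollKer_contDiff n) hf

theorem fderiv_moll_apply (n : ℕ) {f : Rn N → E} (hf : LocallyIntegrable f) (x v : Rn N) :
    fderiv ℝ (moll n f) x v = ∫ t, (fderiv ℝ (mollKer N n) (x - t) v) • f t := by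
  have hc1 : ContDiff ℝ 1 (mollKer N n) := (mollKer_contDiff n).of_le (by simp)
  rw [moll_eq_convolution, ((mollKer_hasCompactSupport n).hasFDerivAt_convolution_left
    (ContinuousLinearMap.lsmul ℝ ℝ) hc1 hf x).fderiv, convolution_eq_swap]
  rw [ContinuousLinearMap.integral_apply]
  · rfl
  · have := ((mollKer_hasCompactSupport n).fderiv (𝕜 := ℝ)).convolutionExists_left
      ((ContinuousLinearMap.lsmul ℝ ℝ : ℝ →L[ℝ] E →L[ℝ] E).precompL (Rn N))
      (hc1.continuous_fderiv one_ne_zero) hf x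
    exact this.integrable_swap

/-- Lebesgue differentiation applies because the ratio of outer to inner radius of the bumps stays
equal to 2. -/
theorem moll_tendsto_ae [CompleteSpace E] {f : Rn N → E} (hf : LocallyIntegrable f) :
    ∀ᵐ x, Tendsto (fun n => moll n f x) atTop (𝓝 (f x)) := by
  have h := ContDiffBump.ae_convolution_tendsto_right_of_locallyIntegrable
    (φ := fun n => mollBump N n) (l := atTop) (K := 2) (μ := volume) (g := f)
    tendsto_one_div_add_atTop_nhds_zero_nat (Eventually.of_forall fun n => by
      change 1 / ((n : ℝ) + 1) ≤ 2 * (1 / (2 * ((n : ℝ) + 1)))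
      rw [mul_one_div, mul_comm 2 ((n : ℝ) + 1), div_mul_cancel_right₀ two_ne_zero, one_div]) hf
  simp only [moll_eq_convolution]
  exact h

theorem moll_mono (n : ℕ) {f g : Rn N → ℝ} (hf : LocallyIntegrable f) (hg : LocallyIntegrable g)
    (h : ∀ᵐ x, f x ≤ g x) (x : Rn N) : moll n f x ≤ moll n g x := by
  refine integral_mono_ae (integrable_mollKer_smul n hf x) (integrable_mollKer_smul n hg x) ?_
  filter_upwards [h] with t ht
  exact mul_le_mul_of_nonneg_left ht (mollKer_nonneg _ _)

theorem moll_nonneg (n : ℕ) {f : Rn N → ℝ} (h : ∀ᵐ x, 0 ≤ f x) (x : Rn N) : 0 ≤ moll n f x := by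
  refine integral_nonneg_of_ae ?_
  filter_upwards [h] with t ht
  exact mul_nonneg (mollKer_nonneg _ _) ht

theorem moll_add (n : ℕ) {f g : Rn N → E} (hf : LocallyIntegrable f) (hg : LocallyIntegrable g)
    (x : Rn N) : moll n (fun t => f t + g t) x = moll n f x + moll n g x := by
  simp only [moll, smul_add]
  exact integral_add (integrable_mollKer_smul n hf x) (integrable_mollKer_smul n hg x)

theorem moll_const_mul (n : ℕ) (c : ℝ) (f : Rn N → ℝ) (x : Rn N) :
    moll n (fun t => c * f t) x = c * moll n f x := by
  simp only [moll, smul_eq_mul, ← integral_const_mul]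
  congr 1; ext t; ring

theorem moll_const (n : ℕ) (c : ℝ) (x : Rn N) : moll n (fun _ => c) x = c := by
  simp only [moll, smul_eq_mul, integral_mul_const]
  rw [integral_sub_left_eq_self (fun t => mollKer N n t) volume x, integral_mollKer, one_mul]

theorem norm_moll_le (n : ℕ) (f : Rn N → E) (x : Rn N) :
    ‖moll n f x‖ ≤ moll n (fun t => ‖f t‖) x := by
  refine (norm_integral_le_integral_norm _).trans (le_of_eq ?_)
  simp only [moll, norm_smul, smul_eq_mul, Real.norm_of_nonneg (mollKer_nonneg n _)]

theorem norm_moll_le_of_norm_le (n : ℕ) {f : Rn N → E} {g : Rn N → ℝ} (hf : LocallyIntegrable f)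
    (hg : LocallyIntegrable g) (h : ∀ᵐ x, ‖f x‖ ≤ g x) (x : Rn N) : ‖moll n f x‖ ≤ moll n g x :=
  (norm_moll_le n f x).trans (moll_mono n (locallyIntegrable_norm hf) hg h x)

/-- Cauchy-Schwarz inequality for mollifications. -/
theorem norm_moll_sq_le (n : ℕ) {f : Rn N → E} {m h : Rn N → ℝ} (hf : LocallyIntegrable f)
    (hm : LocallyIntegrable m) (hh : LocallyIntegrable h) (hm0 : ∀ᵐ x, 0 ≤ m x)
    (hh0 : ∀ᵐ x, 0 ≤ h x) (hle : ∀ᵐ x, ‖f x‖ ^ 2 ≤ m x * h x) (x : Rn N) :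
    ‖moll n f x‖ ^ 2 ≤ moll n m x * moll n h x := by
  -- Young's inequality with a free parameter `t` is linear in `m` and `h`, so the positive linear
  -- operator `moll n` preserves it; optimizing over `t` afterwards restores the product.
  have key : ∀ t : ℝ, 0 < t → 2 * ‖moll n f x‖ ≤ t * moll n m x + t⁻¹ * moll n h x := by
    intro t ht
    have h1 : ∀ᵐ x, ‖f x‖ ≤ (t / 2) * m x + (t⁻¹ / 2) * h x := by
      filter_upwards [hm0, hh0, hle] with y h1 h2 h3
      have ha : 0 ≤ t * m y := by positivity
      have hb : 0 ≤ t⁻¹ * h y := by positivity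
      have hab : (t * m y) * (t⁻¹ * h y) = m y * h y := by field_simp
      have : ‖f y‖ ^ 2 ≤ ((t * m y + t⁻¹ * h y) / 2) ^ 2 := by
        nlinarith [sq_nonneg (t * m y - t⁻¹ * h y)]
      have := abs_le_of_sq_le_sq' this (by positivity)
      linarith [this.2]
    have hm' := locallyIntegrable_const_mul (t / 2) hm
    have hh' := locallyIntegrable_const_mul (t⁻¹ / 2) hh
    have h2 := norm_moll_le_of_norm_le n hf (locallyIntegrable_add hm' hh') h1 x
    rw [moll_add n hm' hh', moll_const_mul, moll_const_mul] at h2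
    linarith
  have ha := moll_nonneg n hm0 x
  have hb := moll_nonneg n hh0 x
  have hc := norm_nonneg (moll n f x)
  set a := moll n m x
  set b := moll n h x
  set c := ‖moll n f x‖
  rcases hc.eq_or_lt with hc0 | hc0
  · rw [← hc0]; simpa using mul_nonneg ha hb
  rcases ha.eq_or_lt with ha0 | ha0
  · exfalso
    -- With `a = 0`, this large `t` would give `2c ≤ c b / (b + 1)`, impossible for `c > 0`.
    have h1 := key ((b + 1) / c) (by positivity)
    rw [← ha0, mul_zero, zero_add, inv_div, div_mul_eq_mul_div, le_div_iff₀ (by positivity)] at h1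
    nlinarith
  · have h1 := key (c / a) (by positivity)
    rw [div_mul_cancel₀ _ ha0.ne', inv_div, div_mul_eq_mul_div] at h1
    have h2 : c ≤ a * b / c := by linarith
    rw [le_div_iff₀ hc0] at h2
    nlinarith

/-- Mollification preserves the integral, so almost everywhere convergence upgrades to `L¹`
convergence by Scheffé's lemma. -/
theorem moll_tendsto_L1 {g : Rn N → ℝ} (hg : Integrable g) (h0 : ∀ᵐ x, 0 ≤ g x) :
    (∀ n, Integrable (moll n g)) ∧
      Tendsto (fun n => ∫ x, |moll n g x - g x|) atTop (𝓝 0) := by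
  have hker : ∀ n, Integrable (mollKer N n) := fun n =>
    (mollKer_contDiff n).continuous.integrable_of_hasCompactSupport (mollKer_hasCompactSupport n)
  have hi : ∀ n, Integrable (moll n g) := fun n => by
    rw [moll_eq_convolution]
    exact (hker n).integrable_convolution _ hg
  refine ⟨hi, tendsto_integral_abs_sub_of_tendsto_integral hi hg
    (fun n => Eventually.of_forall (moll_nonneg n h0)) (moll_tendsto_ae hg.locallyIntegrable) ?_⟩
  refine tendsto_const_nhds.congr fun n => ?_
  rw [moll_eq_convolution, integral_convolution _ (hker n) hg, integral_mollKer]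
  simp

/-- Dominated convergence, with a mollified dominating function. -/
theorem tendsto_integral_of_le_moll {f : ℕ → Rn N → E} {f₀ : Rn N → E} {p : Rn N → ℝ} {R : ℝ}
    (hf : ∀ n, AEStronglyMeasurable (f n)) (hp : LocallyIntegrable p) (hp0 : ∀ᵐ x, 0 ≤ p x)
    (hle : ∀ n x, ‖f n x‖ ≤ moll n p x) (hsupp : ∀ n x, R < ‖x‖ → f n x = 0)
    (hlim : ∀ᵐ x, Tendsto (fun n => f n x) atTop (𝓝 (f₀ x))) :
    Integrable f₀ ∧ Tendsto (fun n => ∫ x, f n x) atTop (𝓝 (∫ x, f₀ x)) := by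
  -- The kernels vanish outside the unit ball, so cutting `p` off at radius `R + 1` makes it
  -- integrable without changing its mollifications on the ball of radius `R`.
  set q : Rn N → ℝ := (Metric.closedBall 0 (R + 1)).indicator p with hq
  have hqi : Integrable q :=
    (hp.integrableOn_isCompact (isCompact_closedBall _ _)).integrable_indicator
      measurableSet_closedBall
  have hq0 : ∀ᵐ x, 0 ≤ q x := by
    filter_upwards [hp0] with x hx
    exact Set.indicator_apply_nonneg (fun _ => hx)
  obtain ⟨h1, h2⟩ := moll_tendsto_L1 hqi hq0
  have heq : ∀ n x, ‖x‖ ≤ R → moll n q x = moll n p x := by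
    intro n x hx
    refine integral_congr_ae (Eventually.of_forall fun t => ?_)
    by_cases ht : t ∈ Metric.closedBall (0 : Rn N) (R + 1)
    · simp only [hq, Set.indicator_of_mem ht]
    · rw [Metric.mem_closedBall, dist_zero_right, not_le] at ht
      have h3 : 1 ≤ ‖x - t‖ := by
        have := norm_sub_norm_le t x
        rw [norm_sub_rev] at this
        linarith
      simp [mollKer_eq_zero h3]
  refine tendsto_integral_of_dominated_L1 hf h1 hqi (fun n => Eventually.of_forall fun x => ?_)
    hlim (moll_tendsto_ae hqi.locallyIntegrable) h2
  rcases le_or_gt ‖x‖ R with hx | hx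
  · rw [heq n x hx]; exact hle n x
  · rw [hsupp n x hx, norm_zero]; exact moll_nonneg n hq0 x

end Mollifier

/-! ### Weak gradients and divergences, and their mollifications. -/

section WeakDerivatives

variable {N : ℕ}

theorem inner_gradient_eq_fderiv (f : Rn N → ℝ) (x v : Rn N) :
    inner ℝ (gradient f x) v = fderiv ℝ f x v := by
  simp [gradient]

theorem inner_gradient_eq_fderiv' (f : Rn N → ℝ) (x v : Rn N) :
    inner ℝ v (gradient f x) = fderiv ℝ f x v := by
  rw [real_inner_comm, inner_gradient_eq_fderiv]

theorem gradient_apply (f : Rn N → ℝ) (x : Rn N) (i : Fin N) :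
    gradient f x i = fderiv ℝ f x (EuclideanSpace.single i 1) := by
  rw [← inner_gradient_eq_fderiv, EuclideanSpace.inner_single_right]
  simp

theorem ext_inner_fderiv {f : Rn N → ℝ} {x G : Rn N} (h : ∀ v, fderiv ℝ f x v = inner ℝ G v) :
    gradient f x = G :=
  ext_inner_right ℝ fun v => by rw [inner_gradient_eq_fderiv, h]

theorem gradient_continuous {f : Rn N → ℝ} (hf : ContDiff ℝ 1 f) : Continuous (gradient f) :=
  (InnerProductSpace.toDual ℝ (Rn N)).symm.continuous.comp (hf.continuous_fderiv one_ne_zero)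

theorem gradient_hasCompactSupport {f : Rn N → ℝ} (hf : HasCompactSupport f) :
    HasCompactSupport (gradient f) := by
  have h := hf.fderiv (𝕜 := ℝ)
  exact h.comp_left (g := (InnerProductSpace.toDual ℝ (Rn N)).symm) (map_zero _)

theorem gradient_mollKer_sub (n : ℕ) (x t v : Rn N) :
    fderiv ℝ (mollKer N n) (x - t) v = - inner ℝ (gradient (fun s => mollKer N n (x - s)) t) v := by
  have h1 : HasFDerivAt (mollKer N n) (fderiv ℝ (mollKer N n) (x - t)) (x - t) :=
    ((mollKer_contDiff n).differentiable (by simp) _).hasFDerivAt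
  have h2 : HasFDerivAt (fun s : Rn N => x - s) (-ContinuousLinearMap.id ℝ (Rn N)) t :=
    (hasFDerivAt_id t).const_sub x
  have h3 : HasFDerivAt (fun s => mollKer N n (x - s)) _ t := h1.comp t h2
  rw [inner_gradient_eq_fderiv, h3.fderiv]
  simp

/-- Mollification commutes with the weak gradient. -/
theorem gradient_moll (n : ℕ) {f : Rn N → ℝ} {G : Rn N → Rn N} (h : HasWeakGradient f G)
    (x : Rn N) : gradient (moll n f) x = moll n G x := by
  obtain ⟨hf, hG, hw⟩ := h
  refine ext_inner_fderiv fun v => ?_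
  have hη := isTest_mollKer_sub n x
  have hi : Integrable fun t => f t • gradient (fun s => mollKer N n (x - s)) t :=
    hf.integrable_smul_right_of_hasCompactSupport
      (gradient_continuous (hη.1.of_le (by simp))) (gradient_hasCompactSupport hη.2)
  have h1 := hw _ hη
  rw [fderiv_moll_apply n hf]
  have h2 : inner ℝ (moll n G x) v
      = - inner ℝ (∫ t, f t • gradient (fun s => mollKer N n (x - s)) t) v := by
    rw [h1, inner_neg_left, neg_neg]; rfl
  rw [h2, real_inner_comm, ← integral_inner hi v, ← integral_neg]
  refine integral_congr_ae (Eventually.of_forall fun t => ?_)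
  dsimp only
  rw [gradient_mollKer_sub, real_inner_smul_right, real_inner_comm v, smul_eq_mul]
  ring

/-- `D` is the distributional divergence of the vector field `B`. -/
def HasWeakDiv (B : Rn N → Rn N) (D : Rn N → ℝ) : Prop :=
  LocallyIntegrable B ∧ LocallyIntegrable D ∧
    ∀ η : Rn N → ℝ, IsTest η → ∫ x, inner ℝ (gradient η x) (B x) = - ∫ x, η x * D x

/-- The divergence of a differentiable vector field. -/
noncomputable def divergence (V : Rn N → Rn N) (x : Rn N) : ℝ :=
  ∑ i, fderiv ℝ V x (EuclideanSpace.single i 1) i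

theorem integrable_inner_of_hasCompactSupport {B V : Rn N → Rn N} (hB : LocallyIntegrable B)
    (hV : Continuous V) (hc : HasCompactSupport V) : Integrable fun x => inner ℝ (V x) (B x) := by
  have h1 : Integrable fun x => ‖V x‖ • B x :=
    hB.integrable_smul_left_of_hasCompactSupport hV.norm hc.norm
  refine h1.norm.mono' (hV.aestronglyMeasurable.inner hB.aestronglyMeasurable)
    (Eventually.of_forall fun x => ?_)
  rw [norm_smul, norm_norm]
  exact norm_inner_le_norm _ _

/-- The reflected kernel `t ↦ mollKer N n (x - t)` is an admissible test function, and the sign from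
the reflection cancels the one in the weak formulation. -/
theorem divergence_moll (n : ℕ) {B : Rn N → Rn N} {D : Rn N → ℝ} (h : HasWeakDiv B D)
    (x : Rn N) : divergence (moll n B) x = moll n D x := by
  obtain ⟨hB, hD, hw⟩ := h
  have hη := isTest_mollKer_sub n x
  have h1 := hw _ hη
  have hc1 : ContDiff ℝ 1 (mollKer N n) := (mollKer_contDiff n).of_le (by simp)
  have hsupp (v : Rn N) : HasCompactSupport fun t => fderiv ℝ (mollKer N n) (x - t) v := by
    have h := (mollKer_hasCompactSupport (N := N) n).fderiv_apply (𝕜 := ℝ) v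
    exact h.comp_homeomorph (Homeomorph.subLeft x)
  have hcont (v : Rn N) : Continuous fun t => fderiv ℝ (mollKer N n) (x - t) v :=
    ((hc1.continuous_fderiv one_ne_zero).comp (continuous_const.sub continuous_id)).clm_apply
      continuous_const
  have hi (v : Rn N) : Integrable fun t => fderiv ℝ (mollKer N n) (x - t) v • B t :=
    hB.integrable_smul_left_of_hasCompactSupport (hcont v) (hsupp v)
  have h2 (i : Fin N) : fderiv ℝ (moll n B) x (EuclideanSpace.single i 1) i
      = ∫ t, fderiv ℝ (mollKer N n) (x - t) (EuclideanSpace.single i 1) * B t i := by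
    rw [fderiv_moll_apply n hB]
    have := (EuclideanSpace.proj (𝕜 := ℝ) i).integral_comp_comm (hi (EuclideanSpace.single i 1))
    simpa using this.symm
  have hi' (i : Fin N) :
      Integrable fun t => fderiv ℝ (mollKer N n) (x - t) (EuclideanSpace.single i 1) * B t i := by
    have := (EuclideanSpace.proj (𝕜 := ℝ) i).integrable_comp (hi (EuclideanSpace.single i 1))
    simpa using this
  unfold divergence
  simp only [h2]
  rw [← integral_finsetSum _ fun i _ => hi' i]
  have h3 : moll n D x = - ∫ t, inner ℝ (gradient (fun s => mollKer N n (x - s)) t) (B t) := by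
    rw [h1, neg_neg]; rfl
  rw [h3, ← integral_neg]
  refine integral_congr_ae (Eventually.of_forall fun t => ?_)
  dsimp only
  simp only [gradient_mollKer_sub]
  rw [PiLp.inner_apply, ← Finset.sum_neg_distrib]
  refine Finset.sum_congr rfl fun i _ => ?_
  rw [gradient_apply]
  simp [mul_comm]

theorem laplacian_eq_sum_fderiv {η : Rn N → ℝ} (hη : ContDiff ℝ ∞ η) (x : Rn N) :
    Laplacian.laplacian η x = ∑ i, gradient
      (fun y => fderiv ℝ η y (EuclideanSpace.single i 1)) x i := by
  rw [InnerProductSpace.laplacian_eq_iteratedFDeriv_orthonormalBasis η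
    (EuclideanSpace.basisFun (Fin N) ℝ)]
  refine Finset.sum_congr rfl fun i _ => ?_
  rw [iteratedFDeriv_two_apply]
  rw [gradient_apply, fderiv_clm_apply _ (differentiableAt_const _)]
  · simp
  · exact ((hη.fderiv_right (m := ∞) (by simp)).differentiable (by simp)) x

/-- The weak gradient is tested with each `∂ᵢη`, and the `i`-th components are summed. Only first
derivatives of `B` are then needed, so mollification acts on `B` and `D` directly. -/
theorem HasWeakLaplacian.hasWeakDiv {f D : Rn N → ℝ} {B : Rn N → Rn N}
    (hD : HasWeakLaplacian f D) (hB : HasWeakGradient f B) : HasWeakDiv B D := by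
  refine ⟨hB.2.1, hD.2.1, fun η hη => ?_⟩
  have hζ (i : Fin N) : IsTest fun y => fderiv ℝ η y (EuclideanSpace.single i 1) :=
    ⟨(hη.1.fderiv_right (m := ∞) (by simp)).clm_apply contDiff_const,
      hη.2.fderiv_apply (𝕜 := ℝ) _⟩
  have hif (i : Fin N) : Integrable fun x =>
      f x • gradient (fun y => fderiv ℝ η y (EuclideanSpace.single i 1)) x :=
    hB.1.integrable_smul_right_of_hasCompactSupport
      (gradient_continuous ((hζ i).1.of_le (by simp))) (gradient_hasCompactSupport (hζ i).2)
  have hiB (i : Fin N) : Integrable fun x => fderiv ℝ η x (EuclideanSpace.single i 1) • B x :=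
    hB.2.1.integrable_smul_left_of_hasCompactSupport (hζ i).1.continuous (hζ i).2
  have h1 (i : Fin N) : ∫ x, f x * gradient
      (fun y => fderiv ℝ η y (EuclideanSpace.single i 1)) x i
      = - ∫ x, fderiv ℝ η x (EuclideanSpace.single i 1) * B x i := by
    have h := congrArg (EuclideanSpace.proj (𝕜 := ℝ) i) (hB.2.2 _ (hζ i))
    rw [map_neg, ← ContinuousLinearMap.integral_comp_comm _ (hif i),
      ← ContinuousLinearMap.integral_comp_comm _ (hiB i)] at h
    simpa using h
  rw [← hD.2.2 η hη]
  simp only [laplacian_eq_sum_fderiv hη.1, Finset.mul_sum]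
  rw [integral_finsetSum]
  · simp only [h1, Finset.sum_neg_distrib, neg_neg]
    rw [← integral_finsetSum]
    · refine integral_congr_ae (Eventually.of_forall fun t => ?_)
      dsimp only
      rw [PiLp.inner_apply]
      refine Finset.sum_congr rfl fun i _ => ?_
      rw [gradient_apply]
      simp [mul_comm]
    · intro i _
      simpa using (EuclideanSpace.proj (𝕜 := ℝ) i).integrable_comp (hiB i)
  · intro i _
    simpa using (EuclideanSpace.proj (𝕜 := ℝ) i).integrable_comp (hif i)

theorem HasWeakGradient.ae_eq {f : Rn N → ℝ} {G G' : Rn N → Rn N} (h : HasWeakGradient f G)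
    (h' : HasWeakGradient f G') : G =ᵐ[volume] G' := by
  have key := ae_eq_zero_of_integral_contDiff_smul_eq_zero (h.2.1.sub h'.2.1)
    (fun η h1 h2 => by
      have ha := h.2.2 η ⟨h1, h2⟩
      rw [h'.2.2 η ⟨h1, h2⟩, neg_inj] at ha
      simp only [Pi.sub_apply, smul_sub]
      rw [integral_sub, ha, sub_self]
      · exact h.2.1.integrable_smul_left_of_hasCompactSupport h1.continuous h2
      · exact h'.2.1.integrable_smul_left_of_hasCompactSupport h1.continuous h2)
  filter_upwards [key] with x hx
  exact sub_eq_zero.1 hx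

theorem hasWeakGradient_weakGradient {f : Rn N → ℝ} (h : ∃ G, HasWeakGradient f G) :
    HasWeakGradient f (weakGradient f) := by
  rw [weakGradient, dif_pos h]
  exact h.choose_spec

theorem hasWeakLaplacian_weakLaplacian {f : Rn N → ℝ} (h : ∃ D, HasWeakLaplacian f D) :
    HasWeakLaplacian f (weakLaplacian f) := by
  rw [weakLaplacian, dif_pos h]
  exact h.choose_spec

/-- Integration by parts against a differentiable vector field. -/
theorem integral_inner_gradient_eq_neg {f : Rn N → ℝ} {V : Rn N → Rn N} (hf : ContDiff ℝ 1 f)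
    (hc : HasCompactSupport f) (hV : ContDiff ℝ 1 V) :
    ∫ x, inner ℝ (gradient f x) (V x) = - ∫ x, f x * divergence V x := by
  have hVi (i : Fin N) : ContDiff ℝ 1 fun x => V x i :=
    (EuclideanSpace.proj (𝕜 := ℝ) i).contDiff.comp hV
  have hd (i : Fin N) (x : Rn N) : fderiv ℝ (fun x => V x i) x (EuclideanSpace.single i 1)
      = fderiv ℝ V x (EuclideanSpace.single i 1) i := by
    have h := (EuclideanSpace.proj (𝕜 := ℝ) i).hasFDerivAt.comp x
      (hV.differentiable one_ne_zero x).hasFDerivAt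
    have h' : HasFDerivAt (fun x => V x i) _ x := h
    rw [h'.fderiv]
    simp
  have hfi (i : Fin N) : Continuous fun x => fderiv ℝ f x (EuclideanSpace.single i 1) :=
    (hf.continuous_fderiv one_ne_zero).clm_apply continuous_const
  have hVd (i : Fin N) : Continuous fun x => fderiv ℝ (fun x => V x i) x
      (EuclideanSpace.single i 1) :=
    ((hVi i).continuous_fderiv one_ne_zero).clm_apply continuous_const
  have i1 (i : Fin N) : Integrable fun x =>
      fderiv ℝ f x (EuclideanSpace.single i 1) * V x i :=
    ((hfi i).mul (hVi i).continuous).integrable_of_hasCompactSupport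
      (hc.fderiv_apply (𝕜 := ℝ) _).mul_right
  have i2 (i : Fin N) : Integrable fun x =>
      f x * fderiv ℝ (fun x => V x i) x (EuclideanSpace.single i 1) :=
    (hf.continuous.mul (hVd i)).integrable_of_hasCompactSupport hc.mul_right
  have i3 (i : Fin N) : Integrable fun x => f x * V x i :=
    (hf.continuous.mul (hVi i).continuous).integrable_of_hasCompactSupport hc.mul_right
  have key (i : Fin N) := integral_mul_fderiv_eq_neg_fderiv_mul_of_integrable (μ := volume)
    (i1 i) (i2 i) (i3 i) (fun x _ => hf.differentiable one_ne_zero x)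
    (fun x _ => (hVi i).differentiable one_ne_zero x)
  have e1 (x : Rn N) : inner ℝ (gradient f x) (V x)
      = ∑ i, fderiv ℝ f x (EuclideanSpace.single i 1) * V x i := by
    rw [PiLp.inner_apply]
    refine Finset.sum_congr rfl fun i _ => ?_
    rw [gradient_apply]
    simp [mul_comm]
  have e2 (x : Rn N) : f x * divergence V x
      = ∑ i, f x * fderiv ℝ (fun x => V x i) x (EuclideanSpace.single i 1) := by
    simp only [divergence, Finset.mul_sum, hd]
  simp only [e1, e2]
  rw [integral_finsetSum _ fun i _ => i1 i, integral_finsetSum _ fun i _ => i2 i]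
  simp only [key, Finset.sum_neg_distrib, neg_neg]

/-- Limits of smooth functions, dominated together with their gradients by mollifications. -/
theorem hasWeakGradient_of_le_moll {f : ℕ → Rn N → ℝ} {f₀ : Rn N → ℝ} {G₀ : Rn N → Rn N}
    {p : Rn N → ℝ} (hf : ∀ n, ContDiff ℝ 1 (f n)) (hp : LocallyIntegrable p)
    (hp0 : ∀ᵐ x, 0 ≤ p x) (hf₀ : LocallyIntegrable f₀) (hG₀ : LocallyIntegrable G₀)
    (hle : ∀ n x, |f n x| ≤ moll n p x) (hle' : ∀ n x, ‖gradient (f n) x‖ ≤ moll n p x)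
    (hlim : ∀ᵐ x, Tendsto (fun n => f n x) atTop (𝓝 (f₀ x)))
    (hlim' : ∀ᵐ x, Tendsto (fun n => gradient (f n) x) atTop (𝓝 (G₀ x))) :
    HasWeakGradient f₀ G₀ := by
  refine ⟨hf₀, hG₀, fun η hη => ?_⟩
  have hη1 : ContDiff ℝ 1 η := hη.1.of_le (by simp)
  have hgη := gradient_continuous hη1
  obtain ⟨R, hR⟩ := hη.2.isCompact.isBounded.subset_closedBall (0 : Rn N)
  have hR0 : ∀ x : Rn N, R < ‖x‖ → x ∉ tsupport η := fun x hx h => by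
    have := hR h
    rw [Metric.mem_closedBall, dist_zero_right] at this
    linarith
  have hηR : ∀ x : Rn N, R < ‖x‖ → η x = 0 := fun x hx => image_eq_zero_of_notMem_tsupport (hR0 x hx)
  have hgR : ∀ x : Rn N, R < ‖x‖ → gradient η x = 0 := fun x hx => by
    have : fderiv ℝ η x = 0 := fderiv_of_notMem_tsupport (𝕜 := ℝ) (hR0 x hx)
    simp [gradient, this]
  obtain ⟨C₁, hC₁⟩ := hη1.continuous.bounded_above_of_compact_support hη.2
  obtain ⟨C₂, hC₂⟩ := hgη.bounded_above_of_compact_support (gradient_hasCompactSupport hη.2)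
  have hC₁0 : 0 ≤ C₁ := (norm_nonneg _).trans (hC₁ 0)
  have hC₂0 : 0 ≤ C₂ := (norm_nonneg _).trans (hC₂ 0)
  have h1 := (tendsto_integral_of_le_moll (R := R) (f := fun n x => f n x • gradient η x)
    (f₀ := fun x => f₀ x • gradient η x)
    (fun n => ((hf n).continuous.smul hgη).aestronglyMeasurable)
    (locallyIntegrable_const_mul C₂ hp)
    (hp0.mono fun x hx => mul_nonneg hC₂0 hx) (fun n x => by
      rw [norm_smul, moll_const_mul, mul_comm]
      exact mul_le_mul (hC₂ x) (hle n x) (norm_nonneg _) hC₂0)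
    (fun n x hx => by rw [hgR x hx, smul_zero])
    (hlim.mono fun x hx => hx.smul_const _)).2
  have h2 := (tendsto_integral_of_le_moll (R := R) (f := fun n x => η x • gradient (f n) x)
    (f₀ := fun x => η x • G₀ x)
    (fun n => (hη1.continuous.smul (gradient_continuous (hf n))).aestronglyMeasurable)
    (locallyIntegrable_const_mul C₁ hp)
    (hp0.mono fun x hx => mul_nonneg hC₁0 hx) (fun n x => by
      rw [norm_smul, moll_const_mul]
      exact mul_le_mul (hC₁ x) (hle' n x) (norm_nonneg _) hC₁0)
    (fun n x hx => by rw [hηR x hx, zero_smul])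
    (hlim'.mono fun x hx => hx.const_smul _)).2
  have h3 (n : ℕ) : ∫ x, f n x • gradient η x = - ∫ x, η x • gradient (f n) x := by
    have i1 : Integrable fun x => f n x • gradient η x :=
      ((hf n).continuous.smul hgη).integrable_of_hasCompactSupport
        (gradient_hasCompactSupport hη.2).smul_left
    have i2 : Integrable fun x => η x • gradient (f n) x :=
      (hη1.continuous.smul (gradient_continuous (hf n))).integrable_of_hasCompactSupport
        hη.2.smul_right
    refine ext_inner_right ℝ fun v => ?_
    rw [inner_neg_left, real_inner_comm, real_inner_comm v, ← integral_inner i1 v,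
      ← integral_inner i2 v]
    have h := integral_mul_fderiv_eq_neg_fderiv_mul_of_integrable (μ := volume) (f := f n) (g := η)
      (v := v) ?_ ?_ ?_ (fun x _ => (hf n).differentiable one_ne_zero x)
      (fun x _ => hη1.differentiable one_ne_zero x)
    · simp only [real_inner_smul_right, inner_gradient_eq_fderiv'] at h ⊢
      rw [h]
      simp only [mul_comm]
    · have := i2.const_inner (𝕜 := ℝ) v
      simp only [real_inner_smul_right, inner_gradient_eq_fderiv'] at this
      simpa only [mul_comm] using this
    · have := i1.const_inner (𝕜 := ℝ) v
      simpa only [real_inner_smul_right, inner_gradient_eq_fderiv'] using this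
    · exact ((hf n).continuous.mul hη1.continuous).integrable_of_hasCompactSupport hη.2.mul_left
  simp only [h3] at h1
  exact tendsto_nhds_unique h1 h2.neg

end WeakDerivatives

/-! ### Chain rules for weak gradients. -/

section ChainRules

variable {N : ℕ}

theorem gradient_eq_of_hasFDerivAt {f : Rn N → ℝ} {f' : Rn N →L[ℝ] ℝ} {x G : Rn N}
    (h : HasFDerivAt f f' x) (hG : ∀ v, f' v = inner ℝ G v) : gradient f x = G :=
  ext_inner_fderiv fun v => by rw [h.fderiv, hG]

theorem hasFDerivAt_moll (n : ℕ) {f : Rn N → ℝ} {G : Rn N → Rn N} (h : HasWeakGradient f G)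
    (x : Rn N) : HasFDerivAt (moll n f) (innerSL ℝ (moll n G x)) x := by
  have h1 := ((moll_contDiff n h.1).differentiable (by simp) x).hasFDerivAt
  have h2 : fderiv ℝ (moll n f) x = innerSL ℝ (moll n G x) := ContinuousLinearMap.ext fun v => by
    rw [← inner_gradient_eq_fderiv, gradient_moll n h]
    rfl
  rwa [h2] at h1

theorem norm_moll_sq_le_moll_sq {E : Type*} [NormedAddCommGroup E] [NormedSpace ℝ E] (n : ℕ)
    {f : Rn N → E} (hf : LocallyIntegrable f) (hf2 : LocallyIntegrable fun x => ‖f x‖ ^ 2)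
    (x : Rn N) : ‖moll n f x‖ ^ 2 ≤ moll n (fun x => ‖f x‖ ^ 2) x := by
  have h := norm_moll_sq_le n hf (locallyIntegrable_const (1 : ℝ)) hf2
    (Eventually.of_forall fun _ => zero_le_one)
    (Eventually.of_forall fun _ => by positivity) (Eventually.of_forall fun _ => by simp) x
  rwa [moll_const, one_mul] at h

/-- Squares of mollifications and their gradients are dominated by the mollification of `|u|² +
|G|²`, by Cauchy-Schwarz. The intended case is `u = √μ`. -/
theorem HasWeakGradient.sq {u : Rn N → ℝ} {G : Rn N → Rn N} (h : HasWeakGradient u G)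
    (hu : LocallyIntegrable fun x => ‖u x‖ ^ 2) (hG : LocallyIntegrable fun x => ‖G x‖ ^ 2) :
    HasWeakGradient (fun x => u x ^ 2) (fun x => (2 * u x) • G x) := by
  have hp := locallyIntegrable_add hu hG
  have hgrad (n : ℕ) (x : Rn N) :
      gradient (fun x => moll n u x ^ 2) x = (2 * moll n u x) • moll n G x := by
    refine gradient_eq_of_hasFDerivAt ((hasFDerivAt_moll n h x).pow 2) fun v => ?_
    simp [real_inner_smul_left]
  have hum := h.1.aestronglyMeasurable
  refine hasWeakGradient_of_le_moll (f := fun n x => moll n u x ^ 2)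
    (p := fun x => ‖u x‖ ^ 2 + ‖G x‖ ^ 2)
    (fun n => ((moll_contDiff n h.1).of_le (by simp)).pow 2) hp
    (Eventually.of_forall fun x => by positivity) ?_ ?_ ?_ ?_ ?_ ?_
  · exact hu.mono (hum.pow 2) (Eventually.of_forall fun x => by simp)
  · refine hp.mono ((hum.const_mul 2).smul h.2.1.aestronglyMeasurable)
      (Eventually.of_forall fun x => ?_)
    rw [norm_smul, norm_mul, Real.norm_of_nonneg (by norm_num : (0 : ℝ) ≤ 2),
      Real.norm_of_nonneg (by positivity : 0 ≤ ‖u x‖ ^ 2 + ‖G x‖ ^ 2)]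
    nlinarith [sq_nonneg (‖u x‖ - ‖G x‖)]
  · intro n x
    have h1 := norm_moll_sq_le_moll_sq n h.1 hu x
    have h2 := moll_nonneg n (f := fun x => ‖G x‖ ^ 2)
      (Eventually.of_forall fun x => by positivity) x
    rw [moll_add n hu hG, abs_of_nonneg (by positivity)]
    rw [Real.norm_eq_abs, sq_abs] at h1
    linarith
  · intro n x
    have h1 := norm_moll_sq_le_moll_sq n h.1 hu x
    have h2 := norm_moll_sq_le_moll_sq n h.2.1 hG x
    rw [moll_add n hu hG, hgrad, norm_smul, norm_mul,
      Real.norm_of_nonneg (by norm_num : (0 : ℝ) ≤ 2)]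
    nlinarith [sq_nonneg (‖moll n u x‖ - ‖moll n G x‖)]
  · filter_upwards [moll_tendsto_ae h.1] with x hx
    exact hx.pow 2
  · filter_upwards [moll_tendsto_ae h.1, moll_tendsto_ae h.2.1] with x hx hx'
    simp only [hgrad]
    exact (hx.const_mul 2).smul hx'

theorem hasFDerivAt_div {m w : Rn N → ℝ} {A B x : Rn N}
    (hm : HasFDerivAt m (innerSL ℝ B) x) (hw : HasFDerivAt w (innerSL ℝ A) x) (h0 : m x ≠ 0) :
    HasFDerivAt (fun x => w x / m x) (innerSL ℝ ((m x)⁻¹ • (A - (w x / m x) • B))) x := by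
  have h1 := hw.mul ((hasDerivAt_inv h0).comp_hasFDerivAt x hm)
  have h2 : (fun x => w x / m x) = w * (Inv.inv ∘ m) := by
    funext y; simp [div_eq_mul_inv]
  rw [h2]
  refine h1.congr_fderiv (ContinuousLinearMap.ext fun v => ?_)
  simp only [inner_sub_left, real_inner_smul_left, add_apply,
    smul_apply, innerSL_apply_apply, smul_eq_mul, Function.comp]
  field_simp
  ring

/-- The prefactor `m + e` cancels the denominator produced by differentiating the quotient. The
coefficients of `A` and `B` involve only `S`, `S'` and `y S'`, so bounds on these are uniform in
`e`. -/
theorem gradient_mul_comp_div {m w : Rn N → ℝ} {S : ℝ → ℝ} {A B x : Rn N} {e : ℝ}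
    (hm : HasFDerivAt m (innerSL ℝ B) x) (hw : HasFDerivAt w (innerSL ℝ A) x)
    (hS : Differentiable ℝ S) (he : 0 < m x + e) :
    gradient (fun x => (m x + e) * S (w x / (m x + e))) x
      = deriv S (w x / (m x + e)) • A
        + (S (w x / (m x + e)) - w x / (m x + e) * deriv S (w x / (m x + e))) • B := by
  have h1 : HasFDerivAt (fun x => m x + e) (innerSL ℝ B) x := hm.add_const e
  have h2 := hasFDerivAt_div h1 hw he.ne'
  have h3 := (hS (w x / (m x + e))).hasDerivAt.comp_hasFDerivAt x h2
  refine gradient_eq_of_hasFDerivAt (h1.mul h3) fun v => ?_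
  simp only [inner_add_left, inner_sub_left, real_inner_smul_left, add_apply,
    smul_apply, innerSL_apply_apply, smul_eq_mul]
  field_simp
  ring

/-- Chain rule for truncations of the quotient of two weakly differentiable functions. -/
theorem HasWeakGradient.mul_comp_div {m w : Rn N → ℝ} {A B : Rn N → Rn N}
    (hm : HasWeakGradient m B) (hw : HasWeakGradient w A) (hm0 : ∀ᵐ x, 0 ≤ m x)
    (hz : ∀ᵐ x, m x = 0 → A x = 0 ∧ B x = 0) {S : ℝ → ℝ} (hS : ContDiff ℝ 1 S) {M : ℝ}
    (hS0 : ∀ y, |S y| ≤ M) (hS1 : ∀ y, |deriv S y| ≤ M) (hS2 : ∀ y, |y * deriv S y| ≤ M) :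
    HasWeakGradient (fun x => m x * S (w x / m x)) (fun x => deriv S (w x / m x) • A x
      + (S (w x / m x) - w x / m x * deriv S (w x / m x)) • B x) := by
  have hM : 0 ≤ M := (abs_nonneg _).trans (hS0 0)
  have hS' : Continuous (deriv S) := hS.continuous_deriv le_rfl
  have hmm := hm.1.aestronglyMeasurable
  have hq : AEMeasurable fun x => w x / m x :=
    hw.1.aestronglyMeasurable.aemeasurable.div hmm.aemeasurable
  have hSq : AEStronglyMeasurable fun x => S (w x / m x) :=
    (hS.continuous.measurable.comp_aemeasurable hq).aestronglyMeasurable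
  have hSq' : AEStronglyMeasurable fun x => deriv S (w x / m x) :=
    (hS'.measurable.comp_aemeasurable hq).aestronglyMeasurable
  have i1 : LocallyIntegrable fun x => M * (m x + 1) :=
    locallyIntegrable_const_mul M (locallyIntegrable_add hm.1 (locallyIntegrable_const 1))
  have i2 : LocallyIntegrable fun x => M * ‖A x‖ :=
    locallyIntegrable_const_mul M (locallyIntegrable_norm hw.2.1)
  have i3 : LocallyIntegrable fun x => (2 * M) * ‖B x‖ :=
    locallyIntegrable_const_mul (2 * M) (locallyIntegrable_norm hm.2.1)
  have i23 := locallyIntegrable_add i2 i3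
  have hp := locallyIntegrable_add i1 i23
  have hbd (y : ℝ) (a b : Rn N) :
      ‖deriv S y • a + (S y - y * deriv S y) • b‖ ≤ M * ‖a‖ + 2 * M * ‖b‖ := by
    refine (norm_add_le _ _).trans (add_le_add ?_ ?_)
    · rw [norm_smul]
      exact mul_le_mul_of_nonneg_right (hS1 y) (norm_nonneg _)
    · rw [norm_smul]
      refine mul_le_mul_of_nonneg_right ((norm_sub_le _ _).trans ?_) (norm_nonneg _)
      have h1 := hS0 y
      have h2 := hS2 y
      simp only [Real.norm_eq_abs]
      linarith
  have hmn (n : ℕ) (x : Rn N) : 0 ≤ moll n m x := moll_nonneg n hm0 x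
  have hen (n : ℕ) : (0 : ℝ) < 1 / ((n : ℝ) + 1) := by positivity
  have hen1 (n : ℕ) : 1 / ((n : ℝ) + 1) ≤ 1 := by
    rw [div_le_one (by positivity)]; linarith [(Nat.cast_nonneg n : (0 : ℝ) ≤ n)]
  have hpn (n : ℕ) (x : Rn N) : moll n (fun x => M * (m x + 1) + (M * ‖A x‖ + 2 * M * ‖B x‖)) x
      = M * (moll n m x + 1) + (M * moll n (fun x => ‖A x‖) x
        + 2 * M * moll n (fun x => ‖B x‖) x) := by
    rw [moll_add n i1 i23, moll_add n i2 i3, moll_const_mul, moll_const_mul, moll_const_mul,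
      moll_add n hm.1 (locallyIntegrable_const 1), moll_const]
  have hgrad (n : ℕ) (x : Rn N) := gradient_mul_comp_div (hasFDerivAt_moll n hm x)
    (hasFDerivAt_moll n hw x) (hS.differentiable one_ne_zero)
    (add_pos_of_nonneg_of_pos (hmn n x) (hen n))
  have hnn (n : ℕ) {E : Type} [NormedAddCommGroup E] (f : Rn N → E) (x : Rn N) :
      0 ≤ moll n (fun x => ‖f x‖) x :=
    moll_nonneg n (Eventually.of_forall fun x => norm_nonneg _) x
  have hlimq : ∀ᵐ x, 0 < m x → Tendsto (fun n : ℕ => moll n w x / (moll n m x + 1 / ((n : ℝ) + 1)))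
      atTop (𝓝 (w x / m x)) := by
    filter_upwards [moll_tendsto_ae hm.1, moll_tendsto_ae hw.1] with x h1 h2 h3
    have h4 := h1.add tendsto_one_div_add_atTop_nhds_zero_nat
    rw [add_zero] at h4
    exact h2.div h4 h3.ne'
  refine hasWeakGradient_of_le_moll
    (f := fun n x => (moll n m x + 1 / ((n : ℝ) + 1)) *
      S (moll n w x / (moll n m x + 1 / ((n : ℝ) + 1))))
    (p := fun x => M * (m x + 1) + (M * ‖A x‖ + 2 * M * ‖B x‖)) (fun n => ?_) hp ?_ ?_ ?_ ?_ ?_ ?_ ?_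
  · have h1 : ContDiff ℝ 1 fun x => moll n m x + 1 / ((n : ℝ) + 1) :=
      ((moll_contDiff n hm.1).of_le (by simp)).add contDiff_const
    exact h1.mul (hS.comp (((moll_contDiff n hw.1).of_le (by simp)).div h1 fun x =>
      (add_pos_of_nonneg_of_pos (hmn n x) (hen n)).ne'))
  · filter_upwards [hm0] with x hx
    positivity
  · refine hp.mono (hmm.mul hSq) ?_
    filter_upwards [hm0] with x hx
    rw [norm_mul, Real.norm_of_nonneg hx, Real.norm_of_nonneg
      (by positivity : 0 ≤ M * (m x + 1) + (M * ‖A x‖ + 2 * M * ‖B x‖))]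
    have h1 := mul_le_mul_of_nonneg_left (hS0 (w x / m x)) hx
    have h2 : 0 ≤ M * ‖A x‖ + 2 * M * ‖B x‖ := by positivity
    rw [Real.norm_eq_abs]
    nlinarith
  · refine hp.mono ((hSq'.smul hw.2.1.aestronglyMeasurable).add
      ((hSq.sub (hq.aestronglyMeasurable.mul hSq')).smul hm.2.1.aestronglyMeasurable)) ?_
    filter_upwards [hm0] with x hx
    refine (hbd _ _ _).trans ?_
    rw [Real.norm_of_nonneg (by positivity)]
    have : 0 ≤ M * (m x + 1) := by positivity
    linarith
  · intro n x
    have h1 := hmn n x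
    have h2 := hnn n A x
    have h3 := hnn n B x
    rw [hpn, abs_mul, abs_of_nonneg (add_pos_of_nonneg_of_pos h1 (hen n)).le]
    have h4 : (moll n m x + 1 / ((n : ℝ) + 1)) *
        |S (moll n w x / (moll n m x + 1 / ((n : ℝ) + 1)))| ≤ (moll n m x + 1) * M :=
      mul_le_mul (by linarith [hen1 n]) (hS0 _) (abs_nonneg _) (by linarith)
    have h5 : 0 ≤ M * moll n (fun x => ‖A x‖) x + 2 * M * moll n (fun x => ‖B x‖) x := by
      positivity
    linarith
  · intro n x
    have h1 := hmn n x
    rw [hpn, hgrad]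
    refine (hbd _ _ _).trans ?_
    have h4 := mul_le_mul_of_nonneg_left (norm_moll_le n A x) hM
    have h5 := mul_le_mul_of_nonneg_left (norm_moll_le n B x) hM
    have h6 : 0 ≤ M * (moll n m x + 1) := by positivity
    linarith
  · filter_upwards [hm0, hlimq, moll_tendsto_ae hm.1] with x h0 h1 h2
    have h4 := h2.add tendsto_one_div_add_atTop_nhds_zero_nat
    rw [add_zero] at h4
    -- Where `m = 0` the regularized quotients need not converge, but `S` is bounded and its
    -- prefactor tends to zero.
    rcases h0.eq_or_lt with h | h
    · rw [← h] at h4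
      rw [← h, zero_mul]
      refine squeeze_zero_norm (fun n => ?_) (a := fun n : ℕ => (moll n m x + 1 / ((n : ℝ) + 1)) * M)
        (by simpa only [zero_mul] using h4.mul_const M)
      rw [norm_mul, Real.norm_of_nonneg (add_pos_of_nonneg_of_pos (hmn n x) (hen n)).le]
      exact mul_le_mul_of_nonneg_left (hS0 _) (add_pos_of_nonneg_of_pos (hmn n x) (hen n)).le
    · exact h4.mul ((hS.continuous.tendsto _).comp (h1 h))
  · filter_upwards [hm0, hlimq, hz, moll_tendsto_ae hw.2.1, moll_tendsto_ae hm.2.1]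
      with x h0 h1 h2 h3 h4
    simp only [hgrad]
    -- Where `m = 0` both `A` and `B` vanish, and the uniform bound on their coefficients forces the
    -- gradients to zero.
    rcases h0.eq_or_lt with h | h
    · obtain ⟨hA, hB⟩ := h2 h.symm
      rw [hA, hB, smul_zero, smul_zero, add_zero]
      rw [hA] at h3
      rw [hB] at h4
      refine squeeze_zero_norm (fun n => hbd _ _ _) ?_
      simpa using (h3.norm.const_mul M).add (h4.norm.const_mul (2 * M))
    · have h5 := (hS'.tendsto _).comp (h1 h)
      have h6 := (hS.continuous.tendsto _).comp (h1 h)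
      exact (h5.smul h3).add ((h6.sub ((h1 h).mul h5)).smul h4)

end ChainRules

/-! ### The ground state inequality, from smooth to rough densities. -/

section GroundState

variable {N : ℕ}

theorem divergence_continuous {V : Rn N → Rn N} (hV : ContDiff ℝ 1 V) :
    Continuous (divergence V) := by
  refine continuous_finsetSum _ fun i _ => ?_
  exact (EuclideanSpace.proj (𝕜 := ℝ) i).continuous.comp
    ((hV.continuous_fderiv one_ne_zero).clm_apply continuous_const)

theorem hasFDerivAt_gradient {f : Rn N → ℝ} {x : Rn N} (h : DifferentiableAt ℝ f x) :
    HasFDerivAt f (innerSL ℝ (gradient f x)) x := by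
  refine h.hasFDerivAt.congr_fderiv (ContinuousLinearMap.ext fun v => ?_)
  rw [← inner_gradient_eq_fderiv]
  rfl

/-- The ground state inequality for smooth data. -/
theorem integral_groundState_nonneg {f m : Rn N → ℝ} {B V : Rn N → Rn N} (hf : ContDiff ℝ 1 f)
    (hc : HasCompactSupport f) (hm : ContDiff ℝ 1 m) (hm0 : ∀ x, 0 < m x)
    (hB : ∀ x, gradient m x = B x) (hBc : ContDiff ℝ 1 B) (hV : ContDiff ℝ 1 V) :
    0 ≤ ∫ x, (‖gradient f x‖ ^ 2 * m x + f x ^ 2 * ‖B x‖ ^ 2 / (4 * m x)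
      - 1 / 2 * f x ^ 2 * divergence B x + f x ^ 2 * m x * (‖V x‖ ^ 2 + divergence V x)) := by
  have hgf := gradient_continuous hf
  have hf2 : ContDiff ℝ 1 fun x => f x ^ 2 := hf.pow 2
  have hf2m : ContDiff ℝ 1 fun x => f x ^ 2 * m x := hf2.mul hm
  have hc2 : HasCompactSupport fun x => f x ^ 2 :=
    hc.comp_left (g := fun t : ℝ => t ^ 2) (by simp)
  have hc2m : HasCompactSupport fun x => f x ^ 2 * m x := hc2.mul_right
  have g1 (x : Rn N) : gradient (fun x => f x ^ 2) x = (2 * f x) • gradient f x := by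
    refine gradient_eq_of_hasFDerivAt
      ((hasFDerivAt_gradient (hf.differentiable one_ne_zero x)).pow 2) fun v => ?_
    simp [real_inner_smul_left]
  have g2 (x : Rn N) : gradient (fun x => f x ^ 2 * m x) x
      = (2 * f x * m x) • gradient f x + (f x ^ 2) • B x := by
    refine gradient_eq_of_hasFDerivAt
      (((hasFDerivAt_gradient (hf.differentiable one_ne_zero x)).pow 2).mul
        (hasFDerivAt_gradient (hm.differentiable one_ne_zero x))) fun v => ?_
    simp [real_inner_smul_left, inner_add_left, hB]
    ring
  have ib1 := integral_inner_gradient_eq_neg hf2 hc2 hBc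
  have ib2 := integral_inner_gradient_eq_neg hf2m hc2m hV
  have hdB := divergence_continuous hBc
  have hdV := divergence_continuous hV
  have i1 : Integrable fun x => inner ℝ (gradient (fun x => f x ^ 2) x) (B x) :=
    integrable_inner_of_hasCompactSupport hBc.continuous.locallyIntegrable (gradient_continuous hf2)
      (gradient_hasCompactSupport hc2)
  have i2 : Integrable fun x => f x ^ 2 * divergence B x :=
    (hf2.continuous.mul hdB).integrable_of_hasCompactSupport hc2.mul_right
  have i3 : Integrable fun x => inner ℝ (gradient (fun x => f x ^ 2 * m x) x) (V x) :=
    integrable_inner_of_hasCompactSupport hV.continuous.locallyIntegrable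
      (gradient_continuous hf2m) (gradient_hasCompactSupport hc2m)
  have i4 : Integrable fun x => f x ^ 2 * m x * divergence V x :=
    (hf2m.continuous.mul hdV).integrable_of_hasCompactSupport hc2m.mul_right
  have hZ : Continuous fun x => (2 * m x)⁻¹ • B x - V x :=
    (((continuous_const.mul hm.continuous).inv₀ fun x =>
      mul_ne_zero two_ne_zero (hm0 x).ne').smul hBc.continuous).sub hV.continuous
  have i0 : Integrable fun x => ‖gradient f x + f x • ((2 * m x)⁻¹ • B x - V x)‖ ^ 2 * m x := by
    have hcs : HasCompactSupport fun x => gradient f x + f x • ((2 * m x)⁻¹ • B x - V x) :=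
      (gradient_hasCompactSupport hc).add (hc.smul_right (f' := fun x => (2 * m x)⁻¹ • B x - V x))
    have hcs2 : HasCompactSupport
        fun x => ‖gradient f x + f x • ((2 * m x)⁻¹ • B x - V x)‖ ^ 2 :=
      hcs.norm.comp_left (g := fun t : ℝ => t ^ 2) (by simp)
    have hcont : Continuous fun x => gradient f x + f x • ((2 * m x)⁻¹ • B x - V x) :=
      hgf.add (hf.continuous.smul hZ)
    exact ((hcont.norm.pow 2).mul hm.continuous).integrable_of_hasCompactSupport hcs2.mul_right
  -- Completing the square: the integrand is a nonnegative square plus two total divergences, those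
  -- of `f² B` and `f² m V`, which integrate to zero.
  have key : ∀ x, ‖gradient f x‖ ^ 2 * m x + f x ^ 2 * ‖B x‖ ^ 2 / (4 * m x)
      - 1 / 2 * f x ^ 2 * divergence B x + f x ^ 2 * m x * (‖V x‖ ^ 2 + divergence V x)
      = ‖gradient f x + f x • ((2 * m x)⁻¹ • B x - V x)‖ ^ 2 * m x
        - 1 / 2 * (inner ℝ (gradient (fun x => f x ^ 2) x) (B x) + f x ^ 2 * divergence B x)
        + (inner ℝ (gradient (fun x => f x ^ 2 * m x) x) (V x)
          + f x ^ 2 * m x * divergence V x) := by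
    intro x
    have := (hm0 x).ne'
    rw [g1, g2, norm_add_sq_real, norm_smul, mul_pow, norm_sub_sq_real]
    simp only [inner_add_left, inner_sub_right, real_inner_smul_left, real_inner_smul_right,
      norm_smul, mul_pow, Real.norm_eq_abs, sq_abs]
    field_simp
    ring
  simp only [key]
  have i12 := (i1.add i2).const_mul (1 / 2)
  rw [integral_add, integral_sub, integral_const_mul, integral_add i1 i2, integral_add i3 i4, ib1,
    ib2]
  · have : 0 ≤ ∫ x, ‖gradient f x + f x • ((2 * m x)⁻¹ • B x - V x)‖ ^ 2 * m x :=
      integral_nonneg fun x => mul_nonneg (sq_nonneg _) (hm0 x).le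
    linarith
  · exact i0
  · exact i12
  · exact i0.sub i12
  · exact i3.add i4

/-- The integrand of the ground state inequality, for a density `m` with gradient `B` and
Laplacian `D`, and the function `c * y`, where `c` has gradient `g` and `y * m` has gradient `A`. -/
noncomputable def gsIntegrand (c : ℝ) (g : Rn N) (y m : ℝ) (A B : Rn N) (D s : ℝ) : ℝ :=
  ‖y • g + (c / m) • (A - y • B)‖ ^ 2 * m + (c * y) ^ 2 * ‖B‖ ^ 2 / (4 * m)
    - 1 / 2 * (c * y) ^ 2 * D + (c * y) ^ 2 * m * s

/-- The hypotheses on `A` and `B` remove every `1 / m`. The resulting bound is linear in `m`, `h`,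
`b`, `|D|`, so for mollified data it is itself a mollification. -/
theorem abs_gsIntegrand_le {c : ℝ} {g : Rn N} {y m : ℝ} {A B : Rn N} {D s k C h b : ℝ}
    (hm : 0 < m) (hy : |y| ≤ k) (hc : |c| ≤ C) (hg : ‖g‖ ≤ C) (hs : |c ^ 2 * s| ≤ C)
    (hA : ‖A‖ ^ 2 ≤ m * h) (hB : ‖B‖ ^ 2 ≤ m * b) :
    |gsIntegrand c g y m A B D s|
      ≤ (3 * C ^ 2 * (1 + 2 * k ^ 2) + k ^ 2 * C) * (m + h + b + |D|) := by
  have hk : 0 ≤ k := (abs_nonneg _).trans hy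
  have hC : 0 ≤ C := (abs_nonneg _).trans hc
  have hh : 0 ≤ h := nonneg_of_mul_nonneg_right ((sq_nonneg _).trans hA) hm
  have hb : 0 ≤ b := nonneg_of_mul_nonneg_right ((sq_nonneg _).trans hB) hm
  have hy2 : y ^ 2 ≤ k ^ 2 := by rw [← sq_abs]; gcongr
  have hc2 : c ^ 2 ≤ C ^ 2 := by rw [← sq_abs]; gcongr
  have hcy : (c * y) ^ 2 ≤ C ^ 2 * k ^ 2 := by rw [mul_pow]; gcongr
  have hAm : ‖A‖ ^ 2 / m ≤ h := by rw [div_le_iff₀ hm]; linarith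
  have hBm : ‖B‖ ^ 2 / m ≤ b := by rw [div_le_iff₀ hm]; linarith
  have t1 : ‖y • g + (c / m) • (A - y • B)‖ ^ 2 * m
      ≤ 3 * (k ^ 2 * C ^ 2 * m + C ^ 2 * h + C ^ 2 * k ^ 2 * b) := by
    have e1 : ‖y • g + (c / m) • (A - y • B)‖
        ≤ |y| * ‖g‖ + |c| / m * ‖A‖ + |c * y| / m * ‖B‖ := by
      have : y • g + (c / m) • (A - y • B) = y • g + (c / m) • A - (c * y / m) • B := by
        rw [smul_sub, smul_smul, ← add_sub_assoc]; congr 2; ring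
      rw [this]
      refine (norm_sub_le _ _).trans (add_le_add ((norm_add_le _ _).trans ?_) ?_)
      · simp [norm_smul, abs_of_pos hm]
      · simp [norm_smul, abs_of_pos hm]
    have e2 : (|y| * ‖g‖ + |c| / m * ‖A‖ + |c * y| / m * ‖B‖) ^ 2
        ≤ 3 * (y ^ 2 * ‖g‖ ^ 2 + (c / m) ^ 2 * ‖A‖ ^ 2 + (c * y / m) ^ 2 * ‖B‖ ^ 2) := by
      have h1 : (|y| * ‖g‖) ^ 2 = y ^ 2 * ‖g‖ ^ 2 := by rw [mul_pow, sq_abs]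
      have h2 : (|c| / m * ‖A‖) ^ 2 = (c / m) ^ 2 * ‖A‖ ^ 2 := by
        rw [mul_pow, div_pow, sq_abs, div_pow]
      have h3 : (|c * y| / m * ‖B‖) ^ 2 = (c * y / m) ^ 2 * ‖B‖ ^ 2 := by
        rw [mul_pow, div_pow, sq_abs, div_pow]
      rw [← h1, ← h2, ← h3]
      nlinarith [sq_nonneg (|y| * ‖g‖ - |c| / m * ‖A‖),
        sq_nonneg (|y| * ‖g‖ - |c * y| / m * ‖B‖), sq_nonneg (|c| / m * ‖A‖ - |c * y| / m * ‖B‖)]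
    have e3 : ‖y • g + (c / m) • (A - y • B)‖ ^ 2
        ≤ 3 * (y ^ 2 * ‖g‖ ^ 2 + (c / m) ^ 2 * ‖A‖ ^ 2 + (c * y / m) ^ 2 * ‖B‖ ^ 2) :=
      (pow_le_pow_left₀ (norm_nonneg _) e1 2).trans e2
    calc ‖y • g + (c / m) • (A - y • B)‖ ^ 2 * m
        ≤ 3 * (y ^ 2 * ‖g‖ ^ 2 + (c / m) ^ 2 * ‖A‖ ^ 2 + (c * y / m) ^ 2 * ‖B‖ ^ 2) * m :=
          mul_le_mul_of_nonneg_right e3 hm.le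
      _ = 3 * (y ^ 2 * ‖g‖ ^ 2 * m + c ^ 2 * (‖A‖ ^ 2 / m) + (c * y) ^ 2 * (‖B‖ ^ 2 / m)) := by
          field_simp
      _ ≤ 3 * (k ^ 2 * C ^ 2 * m + C ^ 2 * h + C ^ 2 * k ^ 2 * b) := by gcongr
  have t2 : (c * y) ^ 2 * ‖B‖ ^ 2 / (4 * m) ≤ C ^ 2 * k ^ 2 * b := by
    have : (c * y) ^ 2 * ‖B‖ ^ 2 / (4 * m) = (c * y) ^ 2 * (‖B‖ ^ 2 / m) / 4 := by
      field_simp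
    rw [this]
    have h1 : (c * y) ^ 2 * (‖B‖ ^ 2 / m) ≤ C ^ 2 * k ^ 2 * b := by gcongr
    have h2 : 0 ≤ C ^ 2 * k ^ 2 * b := by positivity
    linarith
  have t3 : |1 / 2 * (c * y) ^ 2 * D| ≤ C ^ 2 * k ^ 2 * |D| := by
    rw [abs_mul, abs_of_nonneg (by positivity)]
    refine mul_le_mul_of_nonneg_right ?_ (abs_nonneg _)
    have := sq_nonneg (c * y)
    linarith
  have t4 : |(c * y) ^ 2 * m * s| ≤ k ^ 2 * C * m := by
    have : (c * y) ^ 2 * m * s = y ^ 2 * (c ^ 2 * s) * m := by ring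
    rw [this, abs_mul, abs_mul, abs_of_pos hm, abs_of_nonneg (sq_nonneg y)]
    gcongr
  have p1 : 0 ≤ ‖y • g + (c / m) • (A - y • B)‖ ^ 2 * m := by positivity
  have p2 : 0 ≤ (c * y) ^ 2 * ‖B‖ ^ 2 / (4 * m) := by positivity
  have q : |gsIntegrand c g y m A B D s|
      ≤ 3 * (k ^ 2 * C ^ 2 * m + C ^ 2 * h + C ^ 2 * k ^ 2 * b) + C ^ 2 * k ^ 2 * b
        + C ^ 2 * k ^ 2 * |D| + k ^ 2 * C * m := by
    unfold gsIntegrand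
    have := abs_le.1 t3
    have := abs_le.1 t4
    rw [abs_le]
    constructor <;> linarith
  refine q.trans (sub_nonneg.1 ?_)
  have hD := abs_nonneg D
  have : (3 * C ^ 2 * (1 + 2 * k ^ 2) + k ^ 2 * C) * (m + h + b + |D|)
      - (3 * (k ^ 2 * C ^ 2 * m + C ^ 2 * h + C ^ 2 * k ^ 2 * b) + C ^ 2 * k ^ 2 * b
        + C ^ 2 * k ^ 2 * |D| + k ^ 2 * C * m)
      = (3 * C ^ 2 + 3 * C ^ 2 * k ^ 2) * m + (6 * C ^ 2 * k ^ 2 + k ^ 2 * C) * h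
        + (3 * C ^ 2 + 2 * C ^ 2 * k ^ 2 + k ^ 2 * C) * b
        + (3 * C ^ 2 + 5 * C ^ 2 * k ^ 2 + k ^ 2 * C) * |D| := by ring
  rw [this]
  positivity

theorem gsIntegrand_tendsto {ι : Type*} {l : Filter ι} {c : ℝ} {g : Rn N} {y m D : ι → ℝ}
    {A B : ι → Rn N} {y₀ m₀ D₀ s : ℝ} {A₀ B₀ : Rn N} (hm₀ : m₀ ≠ 0) (hy : Tendsto y l (𝓝 y₀))
    (hm : Tendsto m l (𝓝 m₀)) (hA : Tendsto A l (𝓝 A₀)) (hB : Tendsto B l (𝓝 B₀))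
    (hD : Tendsto D l (𝓝 D₀)) :
    Tendsto (fun i => gsIntegrand c g (y i) (m i) (A i) (B i) (D i) s) l
      (𝓝 (gsIntegrand c g y₀ m₀ A₀ B₀ D₀ s)) := by
  unfold gsIntegrand
  have hcy := ((hy.const_mul c).pow 2)
  have h1 : Tendsto (fun i => c / m i) l (𝓝 (c / m₀)) := tendsto_const_nhds.div hm hm₀
  exact ((((((hy.smul_const g).add (h1.smul (hA.sub (hy.smul hB)))).norm.pow 2).mul hm).add
    ((hcy.mul (hB.norm.pow 2)).div (hm.const_mul 4) (by positivity))).sub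
    ((hcy.const_mul (1 / 2)).mul hD)).add ((hcy.mul hm).mul_const s)

variable {m w h b D χ : Rn N → ℝ} {A B V : Rn N → Rn N} {k : ℝ}

theorem IsTest.exists_bound {χ : Rn N → ℝ} (hχ : IsTest χ) {s : Rn N → ℝ} (hs : Continuous s) :
    ∃ R C : ℝ, (∀ x, |χ x| ≤ C) ∧ (∀ x, ‖gradient χ x‖ ≤ C) ∧ (∀ x, |χ x ^ 2 * s x| ≤ C) ∧
      ∀ x, R < ‖x‖ → χ x = 0 ∧ gradient χ x = 0 := by
  have hχ1 : ContDiff ℝ 1 χ := hχ.1.of_le (by simp)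
  obtain ⟨R, hR⟩ := hχ.2.isCompact.isBounded.subset_closedBall (0 : Rn N)
  obtain ⟨C₁, hC₁⟩ := hχ1.continuous.bounded_above_of_compact_support hχ.2
  obtain ⟨C₂, hC₂⟩ := (gradient_continuous hχ1).bounded_above_of_compact_support
    (gradient_hasCompactSupport hχ.2)
  have hc : HasCompactSupport fun x => χ x ^ 2 :=
    hχ.2.comp_left (g := fun t : ℝ => t ^ 2) (by simp)
  obtain ⟨C₃, hC₃⟩ := ((hχ1.continuous.pow 2).mul hs).bounded_above_of_compact_support
    hc.mul_right
  refine ⟨R, max C₁ (max C₂ C₃), fun x => (hC₁ x).trans (le_max_left _ _),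
    fun x => (hC₂ x).trans ((le_max_left _ _).trans (le_max_right _ _)),
    fun x => (hC₃ x).trans ((le_max_right _ _).trans (le_max_right _ _)), fun x hx => ?_⟩
  have hx' : x ∉ tsupport χ := fun h => by
    have := hR h
    rw [Metric.mem_closedBall, dist_zero_right] at this
    linarith
  refine ⟨image_eq_zero_of_notMem_tsupport hx', ?_⟩
  have : fderiv ℝ χ x = 0 := fderiv_of_notMem_tsupport (𝕜 := ℝ) hx'
  simp [gradient, this]

theorem gsIntegrand_zero (y m : ℝ) (A B : Rn N) (D s : ℝ) :
    gsIntegrand 0 (0 : Rn N) y m A B D s = 0 := by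
  simp [gsIntegrand]

/-- The ground state inequality for a regularized density. -/
theorem integral_gsIntegrand_nonneg_of_pos (hm : HasWeakGradient m B) (hD : HasWeakDiv B D)
    (hw : HasWeakGradient w A) (hm0 : ∀ᵐ x, 0 ≤ m x) (hh : LocallyIntegrable h)
    (hb : LocallyIntegrable b) (hh0 : ∀ᵐ x, 0 ≤ h x) (hb0 : ∀ᵐ x, 0 ≤ b x)
    (hA : ∀ᵐ x, ‖A x‖ ^ 2 ≤ m x * h x) (hB : ∀ᵐ x, ‖B x‖ ^ 2 ≤ m x * b x)
    (hk : ∀ᵐ x, |w x| ≤ k * m x) (hχ : IsTest χ) (hV : ContDiff ℝ 1 V) {e : ℝ} (he : 0 < e) :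
    0 ≤ ∫ x, gsIntegrand (χ x) (gradient χ x) (w x / (m x + e)) (m x + e) (A x) (B x) (D x)
      (‖V x‖ ^ 2 + divergence V x) := by
  have hs : Continuous fun x => ‖V x‖ ^ 2 + divergence V x :=
    (hV.continuous.norm.pow 2).add (divergence_continuous hV)
  obtain ⟨R, C, hC1, hC2, hC3, hR⟩ := hχ.exists_bound hs
  have hχ1 : ContDiff ℝ 1 χ := hχ.1.of_le (by simp)
  have hmn (n : ℕ) (x : Rn N) : 0 < moll n m x + e :=
    add_pos_of_nonneg_of_pos (moll_nonneg n hm0 x) he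
  have cm (n : ℕ) : ContDiff ℝ 1 fun x => moll n m x + e :=
    ((moll_contDiff n hm.1).of_le (by simp)).add contDiff_const
  have cy (n : ℕ) : ContDiff ℝ 1 fun x => moll n w x / (moll n m x + e) :=
    ((moll_contDiff n hw.1).of_le (by simp)).div (cm n) fun x => (hmn n x).ne'
  have cB (n : ℕ) : ContDiff ℝ 1 (moll n B) := (moll_contDiff n hm.2.1).of_le (by simp)
  have cA (n : ℕ) : ContDiff ℝ 1 (moll n A) := (moll_contDiff n hw.2.1).of_le (by simp)
  have cD (n : ℕ) : ContDiff ℝ 1 (moll n D) := (moll_contDiff n hD.2.1).of_le (by simp)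
  have dm (n : ℕ) (x : Rn N) : HasFDerivAt (fun x => moll n m x + e) (innerSL ℝ (moll n B x)) x :=
    (hasFDerivAt_moll n hm x).add_const e
  have hgrad (n : ℕ) (x : Rn N) :
      gradient (fun x => χ x * (moll n w x / (moll n m x + e))) x
        = (moll n w x / (moll n m x + e)) • gradient χ x
          + (χ x / (moll n m x + e)) •
            (moll n A x - (moll n w x / (moll n m x + e)) • moll n B x) := by
    refine gradient_eq_of_hasFDerivAt
      ((hasFDerivAt_gradient (hχ1.differentiable one_ne_zero x)).mul
        (hasFDerivAt_div (dm n x) (hasFDerivAt_moll n hw x) (hmn n x).ne')) fun v => ?_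
    simp only [inner_add_left, real_inner_smul_left, add_apply, smul_apply, innerSL_apply_apply,
      smul_eq_mul]
    ring
  have hpos (n : ℕ) : 0 ≤ ∫ x, gsIntegrand (χ x) (gradient χ x)
      (moll n w x / (moll n m x + e)) (moll n m x + e) (moll n A x) (moll n B x) (moll n D x)
      (‖V x‖ ^ 2 + divergence V x) := by
    have h1 := integral_groundState_nonneg (hχ1.mul (cy n)) hχ.2.mul_right (cm n) (hmn n)
      (fun x => gradient_eq_of_hasFDerivAt (dm n x) fun v => rfl) (cB n) hV
    simp only [hgrad, divergence_moll n hD] at h1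
    exact h1
  have iD := locallyIntegrable_norm hD.2.1
  have i1 := locallyIntegrable_add hm.1 (locallyIntegrable_const e)
  have i2 := locallyIntegrable_add i1 hh
  have i3 := locallyIntegrable_add i2 hb
  have i4 := locallyIntegrable_add i3 iD
  have hlim := (tendsto_integral_of_le_moll (R := R)
    (f := fun n x => gsIntegrand (χ x) (gradient χ x)
      (moll n w x / (moll n m x + e)) (moll n m x + e) (moll n A x) (moll n B x) (moll n D x)
      (‖V x‖ ^ 2 + divergence V x))
    (f₀ := fun x => gsIntegrand (χ x) (gradient χ x) (w x / (m x + e)) (m x + e) (A x) (B x) (D x)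
      (‖V x‖ ^ 2 + divergence V x))
    (fun n => ?_) (locallyIntegrable_const_mul (3 * C ^ 2 * (1 + 2 * k ^ 2) + k ^ 2 * C) i4)
    ?_ ?_ ?_ ?_).2
  · exact ge_of_tendsto' hlim hpos
  · have c1 := (cm n).continuous
    have c2 := (cy n).continuous
    have c3 := (cA n).continuous
    have c4 := (cB n).continuous
    have c5 := (cD n).continuous
    have c6 := gradient_continuous hχ1
    have c7 := hχ1.continuous
    have hne (x : Rn N) := (hmn n x).ne'
    refine Continuous.aestronglyMeasurable ?_
    unfold gsIntegrand
    refine (((((c2.smul c6).add ((c7.div c1 hne).smul (c3.sub (c2.smul c4)))).norm.pow 2).mul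
      c1).add ((((c7.mul c2).pow 2).mul (c4.norm.pow 2)).div (continuous_const.mul c1) fun x =>
        mul_ne_zero four_ne_zero (hne x))).sub ((continuous_const.mul ((c7.mul c2).pow 2)).mul c5)
      |>.add ((((c7.mul c2).pow 2).mul c1).mul hs)
  · have hC0 : 0 ≤ C := (abs_nonneg _).trans (hC1 0)
    filter_upwards [hm0, hh0, hb0] with x h1 h2 h3
    positivity
  · intro n x
    rw [moll_const_mul, moll_add n i3 iD, moll_add n i2 hb, moll_add n i1 hh,
      moll_add n hm.1 (locallyIntegrable_const e), moll_const]
    have hC0 : 0 ≤ C := (abs_nonneg _).trans (hC1 0)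
    -- The bound `|w| ≤ k m` passes through the positive operator `moll n`; this keeps the quotient
    -- of the two mollifications bounded.
    have hk0 : |moll n w x| ≤ k * moll n m x := by
      have := norm_moll_le_of_norm_le n hw.1 (locallyIntegrable_const_mul k hm.1) hk x
      rwa [moll_const_mul] at this
    have hkn : 0 ≤ k * moll n m x := (abs_nonneg _).trans hk0
    have hy : |moll n w x / (moll n m x + e)| ≤ |k| := by
      rw [abs_div, abs_of_pos (hmn n x), div_le_iff₀ (hmn n x)]
      have h1 := le_abs_self k
      have h2 := moll_nonneg n hm0 x
      nlinarith [abs_nonneg k]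
    have hA' : ‖moll n A x‖ ^ 2 ≤ (moll n m x + e) * moll n h x := by
      have h1 := norm_moll_sq_le n hw.2.1 hm.1 hh hm0 hh0 hA x
      have h2 := moll_nonneg n hh0 x
      nlinarith
    have hB' : ‖moll n B x‖ ^ 2 ≤ (moll n m x + e) * moll n b x := by
      have h1 := norm_moll_sq_le n hm.2.1 hm.1 hb hm0 hb0 hB x
      have h2 := moll_nonneg n hb0 x
      nlinarith
    refine (abs_gsIntegrand_le (hmn n x) hy (hC1 x) (hC2 x) (hC3 x) hA' hB').trans ?_
    rw [sq_abs]
    refine mul_le_mul_of_nonneg_left ?_ (by positivity)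
    have := norm_moll_le n D x
    rw [Real.norm_eq_abs] at this
    linarith
  · intro n x hx
    obtain ⟨h1, h2⟩ := hR x hx
    simp only [h1, h2, gsIntegrand_zero]
  · filter_upwards [hm0, moll_tendsto_ae hm.1, moll_tendsto_ae hw.1, moll_tendsto_ae hm.2.1,
      moll_tendsto_ae hw.2.1, moll_tendsto_ae hD.2.1] with x h0 h1 h2 h3 h4 h5
    have hne : m x + e ≠ 0 := (add_pos_of_nonneg_of_pos h0 he).ne'
    exact gsIntegrand_tendsto hne (h2.div (h1.add_const e) hne) (h1.add_const e) h4 h3 h5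

/-- The ground state inequality. -/
theorem integral_gsIntegrand_nonneg (hm : HasWeakGradient m B) (hD : HasWeakDiv B D)
    (hw : HasWeakGradient w A) (hm0 : ∀ᵐ x, 0 ≤ m x) (hh : LocallyIntegrable h)
    (hb : LocallyIntegrable b) (hh0 : ∀ᵐ x, 0 ≤ h x) (hb0 : ∀ᵐ x, 0 ≤ b x)
    (hA : ∀ᵐ x, ‖A x‖ ^ 2 ≤ m x * h x) (hB : ∀ᵐ x, ‖B x‖ ^ 2 ≤ m x * b x)
    (hk : ∀ᵐ x, |w x| ≤ k * m x) (hχ : IsTest χ) (hV : ContDiff ℝ 1 V) :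
    Integrable (fun x => gsIntegrand (χ x) (gradient χ x) (w x / m x) (m x) (A x) (B x) (D x)
      (‖V x‖ ^ 2 + divergence V x)) ∧
    0 ≤ ∫ x, gsIntegrand (χ x) (gradient χ x) (w x / m x) (m x) (A x) (B x) (D x)
      (‖V x‖ ^ 2 + divergence V x) := by
  have hs : Continuous fun x => ‖V x‖ ^ 2 + divergence V x :=
    (hV.continuous.norm.pow 2).add (divergence_continuous hV)
  obtain ⟨R, C, hC1, hC2, hC3, hR⟩ := hχ.exists_bound hs
  have hC0 : 0 ≤ C := (abs_nonneg _).trans (hC1 0)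
  have hχ1 : ContDiff ℝ 1 χ := hχ.1.of_le (by simp)
  have hpos (n : ℕ) := integral_gsIntegrand_nonneg_of_pos hm hD hw hm0 hh hb hh0 hb0 hA hB hk hχ hV
    (e := 1 / ((n : ℝ) + 1)) (by positivity)
  -- As `m + 1 / (n + 1) ≤ m + 1`, a single majorant serves for all regularizations, and ordinary
  -- dominated convergence suffices.
  have i4 : LocallyIntegrable fun x => (3 * C ^ 2 * (1 + 2 * k ^ 2) + k ^ 2 * C) *
      (m x + 1 + h x + b x + |D x|) :=
    locallyIntegrable_const_mul _ (locallyIntegrable_add (locallyIntegrable_add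
      (locallyIntegrable_add (locallyIntegrable_add hm.1 (locallyIntegrable_const 1)) hh) hb)
      (locallyIntegrable_norm hD.2.1))
  have hbound : Integrable ((Metric.closedBall (0 : Rn N) R).indicator fun x =>
      (3 * C ^ 2 * (1 + 2 * k ^ 2) + k ^ 2 * C) * (m x + 1 + h x + b x + |D x|)) :=
    (i4.integrableOn_isCompact (isCompact_closedBall _ _)).integrable_indicator
      measurableSet_closedBall
  have meas (e : ℝ) : AEStronglyMeasurable fun x => gsIntegrand (χ x) (gradient χ x)
      (w x / (m x + e)) (m x + e) (A x) (B x) (D x) (‖V x‖ ^ 2 + divergence V x) := by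
    have c1 : AEMeasurable fun x => m x + e := hm.1.aestronglyMeasurable.aemeasurable.add_const e
    have c2 : AEMeasurable fun x => w x / (m x + e) :=
      hw.1.aestronglyMeasurable.aemeasurable.div c1
    have c3 : AEMeasurable A := hw.2.1.aestronglyMeasurable.aemeasurable
    have c4 : AEMeasurable B := hm.2.1.aestronglyMeasurable.aemeasurable
    have c5 : AEMeasurable D := hD.2.1.aestronglyMeasurable.aemeasurable
    have c6 : AEMeasurable (gradient χ) := (gradient_continuous hχ1).aemeasurable
    have c7 : AEMeasurable χ := hχ1.continuous.aemeasurable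
    refine AEMeasurable.aestronglyMeasurable ?_
    unfold gsIntegrand
    exact (((((c2.smul c6).add ((c7.div c1).smul (c3.sub (c2.smul c4)))).norm.pow_const 2).mul
      c1).add ((((c7.mul c2).pow_const 2).mul (c4.norm.pow_const 2)).div (c1.const_mul 4))).sub
      ((((c7.mul c2).pow_const 2).const_mul (1 / 2)).mul c5)
      |>.add ((((c7.mul c2).pow_const 2).mul c1).mul hs.aemeasurable)
  have hlim : ∀ᵐ x, Tendsto (fun n : ℕ => gsIntegrand (χ x) (gradient χ x)
      (w x / (m x + 1 / ((n : ℝ) + 1))) (m x + 1 / ((n : ℝ) + 1)) (A x) (B x) (D x)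
      (‖V x‖ ^ 2 + divergence V x)) atTop (𝓝 (gsIntegrand (χ x) (gradient χ x) (w x / m x) (m x)
        (A x) (B x) (D x) (‖V x‖ ^ 2 + divergence V x))) := by
    filter_upwards [hm0, hA, hB, hk] with x h0 h1 h2 h3
    -- Where `m = 0` also `w`, `A` and `B` vanish, so every regularized integrand is zero. The limit
    -- integrand is zero as well, with `0 / 0 = 0`.
    rcases h0.eq_or_lt with hx | hx
    · rw [← hx] at h1 h2 h3 ⊢
      have hA0 : A x = 0 := by
        rw [zero_mul] at h1; simpa using le_antisymm h1 (sq_nonneg _)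
      have hB0 : B x = 0 := by
        rw [zero_mul] at h2; simpa using le_antisymm h2 (sq_nonneg _)
      have hw0 : w x = 0 := by simpa using h3
      simp [hA0, hB0, hw0, gsIntegrand]
    · have h4 : Tendsto (fun n : ℕ => m x + 1 / ((n : ℝ) + 1)) atTop (𝓝 (m x)) := by
        simpa using tendsto_one_div_add_atTop_nhds_zero_nat.const_add (m x)
      exact gsIntegrand_tendsto hx.ne' (tendsto_const_nhds.div h4 hx.ne') h4 tendsto_const_nhds
        tendsto_const_nhds tendsto_const_nhds
  have hle (n : ℕ) : ∀ᵐ x, ‖gsIntegrand (χ x) (gradient χ x)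
      (w x / (m x + 1 / ((n : ℝ) + 1))) (m x + 1 / ((n : ℝ) + 1)) (A x) (B x) (D x)
      (‖V x‖ ^ 2 + divergence V x)‖ ≤ (Metric.closedBall (0 : Rn N) R).indicator (fun x =>
      (3 * C ^ 2 * (1 + 2 * k ^ 2) + k ^ 2 * C) * (m x + 1 + h x + b x + |D x|)) x := by
    filter_upwards [hm0, hh0, hb0, hA, hB, hk] with x h1 h2 h3 h4 h5 h6
    have hn : (0 : ℝ) < 1 / ((n : ℝ) + 1) := by positivity
    have hn1 : 1 / ((n : ℝ) + 1) ≤ 1 := by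
      rw [div_le_one (by positivity)]; linarith [(Nat.cast_nonneg n : (0 : ℝ) ≤ n)]
    by_cases hx : x ∈ Metric.closedBall (0 : Rn N) R
    · rw [Set.indicator_of_mem hx]
      have hp : 0 < m x + 1 / ((n : ℝ) + 1) := by positivity
      have hy : |w x / (m x + 1 / ((n : ℝ) + 1))| ≤ |k| := by
        rw [abs_div, abs_of_pos hp, div_le_iff₀ hp]
        have := le_abs_self k
        nlinarith [abs_nonneg k]
      refine (abs_gsIntegrand_le (h := h x) (b := b x) hp hy (hC1 x) (hC2 x) (hC3 x) (h4.trans ?_)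
        (h5.trans ?_)).trans ?_
      · exact mul_le_mul_of_nonneg_right (by linarith) h2
      · exact mul_le_mul_of_nonneg_right (by linarith) h3
      · rw [sq_abs]
        refine mul_le_mul_of_nonneg_left ?_ (by positivity)
        linarith
    · rw [Set.indicator_of_notMem hx]
      rw [Metric.mem_closedBall, dist_zero_right, not_le] at hx
      obtain ⟨h1, h2⟩ := hR x hx
      simp only [h1, h2, gsIntegrand_zero, norm_zero, le_refl]
  refine ⟨?_, ?_⟩
  · refine hbound.mono' ?_ ?_
    · simpa using meas 0
    · filter_upwards [ae_all_iff.2 hle, hlim] with x h1 h2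
      exact le_of_tendsto' h2.norm h1
  · exact ge_of_tendsto' (tendsto_integral_of_dominated_convergence _ (fun n => meas _) hbound hle
      hlim) hpos

end GroundState

/-! ### The virtual ground state and its Hardy potential. -/

section HardyField

/-- The radial profile of the logarithmic derivative of the virtual ground state
`|x| ^ (-a) * |log |x|| ^ (1 / 2)`, cut off away from the origin. -/
noncomputable def hardyProfile (a s : ℝ) : ℝ :=
  Real.smoothTransition (2 - 4 * s) * ((a - (Real.log s)⁻¹) / s)

theorem hardyProfile_eq_zero {a s : ℝ} (hs : 1 / 2 ≤ s) : hardyProfile a s = 0 := by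
  rw [hardyProfile, Real.smoothTransition.zero_of_nonpos (by linarith), zero_mul]

theorem hardyProfile_eq {a s : ℝ} (hs : s ≤ 1 / 4) :
    hardyProfile a s = (a - (Real.log s)⁻¹) / s := by
  rw [hardyProfile, Real.smoothTransition.one_of_one_le (by linarith), one_mul]

theorem contDiffAt_hardyProfile (a : ℝ) {s : ℝ} (hs : 0 < s) :
    ContDiffAt ℝ ∞ (hardyProfile a) s := by
  rcases lt_or_ge s 1 with h | h
  · have hlog : Real.log s ≠ 0 := (Real.log_neg hs h).ne
    have h1 : ContDiffAt ℝ ∞ (fun s : ℝ => Real.smoothTransition (2 - 4 * s)) s :=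
      (Real.smoothTransition.contDiff.comp
        (contDiff_const.sub (contDiff_const.mul contDiff_id))).contDiffAt
    exact h1.mul ((contDiffAt_const.sub ((Real.contDiffAt_log.2 hs.ne').inv hlog)).div
      contDiffAt_id hs.ne')
  -- The cutoff vanishes for `s ≥ 1 / 2`, so the pole of `1 / log s` at `s = 1` is never seen.
  · refine (contDiffAt_const (c := (0 : ℝ))).congr_of_eventuallyEq ?_
    filter_upwards [lt_mem_nhds (show (1 / 2 : ℝ) < s by linarith)] with t ht
    exact hardyProfile_eq_zero ht.le

theorem continuousAt_deriv_hardyProfile (a : ℝ) {s : ℝ} (hs : 0 < s) :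
    ContinuousAt (deriv (hardyProfile a)) s :=
  ((contDiffAt_hardyProfile a hs).continuousAt_fderiv (by simp)).clm_apply continuousAt_const

theorem deriv_hardyProfile_eq_zero {a s : ℝ} (hs : 1 / 2 < s) : deriv (hardyProfile a) s = 0 := by
  have : hardyProfile a =ᶠ[𝓝 s] fun _ => 0 := by
    filter_upwards [lt_mem_nhds hs] with t ht
    exact hardyProfile_eq_zero ht.le
  rw [this.deriv_eq, deriv_const]

theorem deriv_hardyProfile {a s : ℝ} (h0 : 0 < s) (hs : s < 1 / 4) :
    deriv (hardyProfile a) s = ((Real.log s)⁻¹ ^ 2 - a + (Real.log s)⁻¹) / s ^ 2 := by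
  have h1 : hardyProfile a =ᶠ[𝓝 s] fun s => (a - (Real.log s)⁻¹) / s := by
    filter_upwards [gt_mem_nhds hs] with t ht
    exact hardyProfile_eq ht.le
  have hlog : Real.log s ≠ 0 := (Real.log_neg h0 (by linarith)).ne
  have h2 : HasDerivAt (fun s => (a - (Real.log s)⁻¹) / s) _ s :=
    (((Real.hasDerivAt_log h0.ne').inv hlog).const_sub a).div (hasDerivAt_id s) h0.ne'
  rw [h1.deriv_eq, h2.deriv, Pi.inv_apply]
  field_simp
  ring

/-- The Hardy potential obtained from `hardyProfile`, with `s = r + d` and `r = |x| ^ 2`. -/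
noncomputable def hardyPotential (N : ℕ) (r s : ℝ) : ℝ :=
  N * hardyProfile (((N : ℝ) - 2) / 2) s + r * (2 * deriv (hardyProfile (((N : ℝ) - 2) / 2)) s
    - hardyProfile (((N : ℝ) - 2) / 2) s ^ 2)

/-- With `a = (N - 2) / 2` and `l = 1 / log s`, the numerator is `(N - 2) a - a² + (2a + 2 - N) l +
l²`. This value of `a` kills the term linear in `l` and leaves `a² + l²`. -/
theorem hardyPotential_self {N : ℕ} {s : ℝ} (h0 : 0 < s) (hs : s < 1 / 4) :
    hardyPotential N s s = (c₀ N + (Real.log s)⁻¹ ^ 2) / s := by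
  rw [hardyPotential, hardyProfile_eq hs.le, deriv_hardyProfile h0 hs, c₀]
  field_simp
  ring

/-- The potential is affine in `r`, so on `0 ≤ r ≤ s` it is enough to look at the endpoints, where
it is nonnegative. -/
theorem hardyPotential_nonneg {N : ℕ} (hN : 2 ≤ N) {r s : ℝ} (hr : 0 ≤ r) (hrs : r ≤ s)
    (h0 : 0 < s) (hs : s < 1 / 4) : 0 ≤ hardyPotential N r s := by
  have hN' : (2 : ℝ) ≤ N := by exact_mod_cast hN
  have hlog : (Real.log s)⁻¹ < 0 := inv_lt_zero.2 (Real.log_neg h0 (by linarith))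
  have h1 : 0 ≤ hardyPotential N s s := by
    rw [hardyPotential_self h0 hs, c₀]; positivity
  have h2 : 0 ≤ N * hardyProfile (((N : ℝ) - 2) / 2) s := by
    rw [hardyProfile_eq hs.le]
    have : 0 ≤ ((N : ℝ) - 2) / 2 - (Real.log s)⁻¹ := by linarith
    positivity
  unfold hardyPotential at h1 ⊢
  rcases le_total 0 (2 * deriv (hardyProfile (((N : ℝ) - 2) / 2)) s
    - hardyProfile (((N : ℝ) - 2) / 2) s ^ 2) with h | h
  · exact add_nonneg h2 (mul_nonneg hr h)
  · linarith [mul_le_mul_of_nonpos_right hrs h]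

/-- A lower bound uniform in the regularization `d = s - r`, as Fatou's lemma requires: the
potential is nonnegative for `s < 1 / 4`, controlled by compactness on `[1 / 4, 1 / 2]`, and zero
beyond. -/
theorem exists_hardyPotential_bound {N : ℕ} (hN : 2 ≤ N) :
    ∃ K : ℝ, 0 ≤ K ∧ ∀ r s : ℝ, 0 ≤ r → r ≤ s → 0 < s → -K ≤ hardyPotential N r s := by
  set p := hardyProfile (((N : ℝ) - 2) / 2) with hp
  -- The factor `1` stands for the bound `r ≤ s ≤ 1 / 2 ≤ 1`.
  have hc : ContinuousOn (fun s => |N * p s| + 1 * |2 * deriv p s - p s ^ 2|)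
      (Set.Icc (1 / 4) (1 / 2)) := by
    have h1 : ContinuousOn p (Set.Icc (1 / 4) (1 / 2)) := fun s hs =>
      (contDiffAt_hardyProfile _ (by linarith [hs.1])).continuousAt.continuousWithinAt
    have h2 : ContinuousOn (deriv p) (Set.Icc (1 / 4) (1 / 2)) := fun s hs =>
      (continuousAt_deriv_hardyProfile _ (by linarith [hs.1])).continuousWithinAt
    exact (continuousOn_const.mul h1).abs.add (continuousOn_const.mul
      ((continuousOn_const.mul h2).sub (h1.pow 2)).abs)
  obtain ⟨K, hK⟩ := isCompact_Icc.bddAbove_image hc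
  refine ⟨max K 0, le_max_right _ _, fun r s hr hrs hs => ?_⟩
  rcases lt_or_ge s (1 / 4) with h | h
  · exact (neg_nonpos.2 (le_max_right _ _)).trans (hardyPotential_nonneg hN hr hrs hs h)
  rcases le_or_gt s (1 / 2) with h' | h'
  · have h1 := hK (Set.mem_image_of_mem _ (show s ∈ Set.Icc (1 / 4) (1 / 2) from ⟨h, h'⟩))
    have h2 := neg_abs_le (N * p s)
    have h3 : |r * (2 * deriv p s - p s ^ 2)| ≤ 1 * |2 * deriv p s - p s ^ 2| := by
      rw [abs_mul, abs_of_nonneg hr]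
      exact mul_le_mul_of_nonneg_right (by linarith) (abs_nonneg _)
    have h4 := neg_abs_le (r * (2 * deriv p s - p s ^ 2))
    have h5 := le_max_left K 0
    unfold hardyPotential
    rw [← hp]
    linarith
  · rw [hardyPotential, hardyProfile_eq_zero h'.le, deriv_hardyProfile_eq_zero h']
    simp

variable {N : ℕ}

/-- The regularized logarithmic gradient of the virtual ground state. -/
noncomputable def hardyField (N : ℕ) (d : ℝ) (x : Rn N) : Rn N :=
  (-hardyProfile (((N : ℝ) - 2) / 2) (‖x‖ ^ 2 + d)) • x

theorem contDiff_hardyField {d : ℝ} (hd : 0 < d) : ContDiff ℝ 1 (hardyField N d) := by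
  suffices h : ContDiff ℝ 1 fun x : Rn N => hardyProfile (((N : ℝ) - 2) / 2) (‖x‖ ^ 2 + d) from
    h.neg.smul contDiff_id
  refine contDiff_iff_contDiffAt.2 fun x => ?_
  have h1 : ContDiffAt ℝ 1 (fun x : Rn N => ‖x‖ ^ 2 + d) x :=
    ((contDiff_norm_sq ℝ).add contDiff_const).contDiffAt
  exact ((contDiffAt_hardyProfile _ (by positivity)).of_le (by simp)).comp x h1

/-- For `V = -p(|x|² + d) x` one has `|V|² = |x|² p²` and `div V = -N p - 2 |x|² p'`. -/
theorem norm_sq_add_divergence_hardyField {d : ℝ} (hd : 0 < d) (x : Rn N) :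
    ‖hardyField N d x‖ ^ 2 + divergence (hardyField N d) x
      = - hardyPotential N (‖x‖ ^ 2) (‖x‖ ^ 2 + d) := by
  have hs : 0 < ‖x‖ ^ 2 + d := by positivity
  set p := hardyProfile (((N : ℝ) - 2) / 2) with hp
  have h1 : HasDerivAt p (deriv p (‖x‖ ^ 2 + d)) (‖x‖ ^ 2 + d) :=
    ((contDiffAt_hardyProfile _ hs).differentiableAt (by simp)).hasDerivAt
  have h2 : HasFDerivAt (fun x : Rn N => ‖x‖ ^ 2 + d) (2 • innerSL ℝ x) x :=
    (hasStrictFDerivAt_norm_sq x).hasFDerivAt.add_const d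
  have h3 : HasFDerivAt (hardyField N d)
      ((-p (‖x‖ ^ 2 + d)) • ContinuousLinearMap.id ℝ (Rn N)
        + (-(deriv p (‖x‖ ^ 2 + d) • 2 • innerSL ℝ x)).smulRight x) x := by
    have h := h1.comp_hasFDerivAt x h2
    exact h.neg.smul (hasFDerivAt_id x)
  have h4 (i : Fin N) : fderiv ℝ (hardyField N d) x (EuclideanSpace.single i 1) i
      = - p (‖x‖ ^ 2 + d) - 2 * deriv p (‖x‖ ^ 2 + d) * (x i) ^ 2 := by
    rw [h3.fderiv]
    simp [EuclideanSpace.inner_single_right]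
    ring
  have h5 : ∑ i, x i ^ 2 = ‖x‖ ^ 2 := by rw [EuclideanSpace.real_norm_sq_eq]
  simp only [divergence, h4]
  rw [Finset.sum_sub_distrib, ← Finset.mul_sum, h5, hardyField, norm_smul, mul_pow, hardyPotential,
    ← hp]
  simp
  ring

theorem tendsto_hardyPotential {r : ℝ} (hr : 0 < r) :
    Tendsto (fun n : ℕ => hardyPotential N r (r + 1 / ((n : ℝ) + 1))) atTop
      (𝓝 (hardyPotential N r r)) := by
  have h1 : Tendsto (fun n : ℕ => r + 1 / ((n : ℝ) + 1)) atTop (𝓝 r) := by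
    simpa using tendsto_one_div_add_atTop_nhds_zero_nat.const_add r
  have h2 := contDiffAt_hardyProfile (((N : ℝ) - 2) / 2) hr
  have h3 := continuousAt_deriv_hardyProfile (((N : ℝ) - 2) / 2) hr
  have h4 := h2.continuousAt.tendsto.comp h1
  have h5 := h3.tendsto.comp h1
  exact (h4.const_mul _).add (((h5.const_mul 2).sub (h4.pow 2)).const_mul r)

end HardyField

/-! ### Smooth truncation of the values of a function. -/

section Truncation

/-- A smooth truncation, tending to the identity as `k → ∞`. -/
noncomputable def trunc (k y : ℝ) : ℝ := y / (1 + y ^ 2 / k)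

variable {k : ℝ}

theorem trunc_denom_pos (hk : 1 ≤ k) (y : ℝ) : 0 < 1 + y ^ 2 / k := by positivity

theorem contDiff_trunc (hk : 1 ≤ k) : ContDiff ℝ 1 (trunc k) :=
  contDiff_id.div (contDiff_const.add ((contDiff_id.pow 2).div_const k)) fun y =>
    (trunc_denom_pos hk y).ne'

theorem deriv_trunc (hk : 1 ≤ k) (y : ℝ) :
    deriv (trunc k) y = (1 - y ^ 2 / k) / (1 + y ^ 2 / k) ^ 2 := by
  have h1 : HasDerivAt (fun y : ℝ => 1 + y ^ 2 / k) (2 * y / k) y := by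
    simpa using ((hasDerivAt_pow 2 y).div_const k).const_add 1
  have h2 : HasDerivAt (trunc k) _ y := (hasDerivAt_id y).div h1 (trunc_denom_pos hk y).ne'
  rw [h2.deriv]
  simp only [id]
  congr 1
  ring

theorem abs_trunc_le_abs (hk : 1 ≤ k) (y : ℝ) : |trunc k y| ≤ |y| := by
  have h0 : 0 ≤ y ^ 2 / k := by positivity
  rw [trunc, abs_div, abs_of_pos (trunc_denom_pos hk y)]
  exact div_le_self (abs_nonneg _) (by linarith)

theorem abs_le_mul_trunc_denom (hk : 1 ≤ k) (y : ℝ) : |y| ≤ k * (1 + y ^ 2 / k) := by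
  rw [mul_add, mul_div_cancel₀ _ (by positivity), mul_one, ← sq_abs]
  nlinarith [sq_nonneg (|y| - 1), abs_nonneg y]

theorem abs_trunc_le (hk : 1 ≤ k) (y : ℝ) : |trunc k y| ≤ k := by
  rw [trunc, abs_div, abs_of_pos (trunc_denom_pos hk y), div_le_iff₀ (trunc_denom_pos hk y)]
  exact abs_le_mul_trunc_denom hk y

theorem abs_deriv_trunc_le (hk : 1 ≤ k) (y : ℝ) :
    |deriv (trunc k) y| ≤ 1 / (1 + y ^ 2 / k) := by
  have h0 : 0 ≤ y ^ 2 / k := by positivity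
  have h1 := trunc_denom_pos hk y
  rw [deriv_trunc hk, abs_div, abs_of_pos (pow_pos h1 2), div_le_div_iff₀ (pow_pos h1 2) h1]
  have : |1 - y ^ 2 / k| ≤ 1 + y ^ 2 / k := by rw [abs_le]; constructor <;> linarith
  nlinarith

theorem abs_deriv_trunc_le_one (hk : 1 ≤ k) (y : ℝ) : |deriv (trunc k) y| ≤ 1 := by
  have h0 : 0 ≤ y ^ 2 / k := by positivity
  refine (abs_deriv_trunc_le hk y).trans ?_
  rw [div_le_one (trunc_denom_pos hk y)]
  linarith

/-- This controls the coefficient `S y - y S' y` of `∇μ` in the chain rule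
`HasWeakGradient.mul_comp_div`. -/
theorem abs_mul_deriv_trunc_le (hk : 1 ≤ k) (y : ℝ) : |y * deriv (trunc k) y| ≤ k := by
  rw [abs_mul]
  refine (mul_le_mul_of_nonneg_left (abs_deriv_trunc_le hk y) (abs_nonneg y)).trans ?_
  rw [mul_one_div, div_le_iff₀ (trunc_denom_pos hk y)]
  exact abs_le_mul_trunc_denom hk y

theorem tendsto_trunc (y : ℝ) :
    Tendsto (fun n : ℕ => trunc ((n : ℝ) + 1) y) atTop (𝓝 y) := by
  have h1 : Tendsto (fun n : ℕ => 1 + y ^ 2 / ((n : ℝ) + 1)) atTop (𝓝 1) := by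
    have := (tendsto_one_div_add_atTop_nhds_zero_nat (𝕜 := ℝ)).const_mul (y ^ 2)
    simpa [div_eq_mul_inv] using this.const_add 1
  have h2 := (tendsto_const_nhds (x := y)).div h1 one_ne_zero
  rwa [div_one] at h2

end Truncation

/-! ### Spatial cutoff by dilated bumps. -/

section Cutoff

variable {N : ℕ}

/-- Smooth spatial cutoff functions with small gradients. -/
theorem exists_cutoff (N : ℕ) : ∃ (χ : ℕ → Rn N → ℝ) (C : ℝ), 0 ≤ C ∧ (∀ n, IsTest (χ n)) ∧
    (∀ n x, |χ n x| ≤ 1) ∧ (∀ n x, ‖gradient (χ n) x‖ ≤ C * (1 / ((n : ℝ) + 1))) ∧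
    ∀ x, Tendsto (fun n => χ n x) atTop (𝓝 1) := by
  let b : ContDiffBump (0 : Rn N) := ⟨1, 2, one_pos, one_lt_two⟩
  have hb1 : ContDiff ℝ 1 b := b.contDiff
  obtain ⟨C, hC⟩ := (gradient_continuous hb1).bounded_above_of_compact_support
    (gradient_hasCompactSupport b.hasCompactSupport)
  have hpos (n : ℕ) : (0 : ℝ) < 1 / ((n : ℝ) + 1) := by positivity
  refine ⟨fun n x => b ((1 / ((n : ℝ) + 1)) • x), C, (norm_nonneg _).trans (hC 0), fun n => ⟨?_, ?_⟩,
    fun n x => ?_, fun n x => ?_, fun x => ?_⟩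
  · exact b.contDiff.comp (contDiff_const_smul _)
  · exact b.hasCompactSupport.comp_homeomorph (Homeomorph.smulOfNeZero _ (hpos n).ne')
  · rw [abs_of_nonneg b.nonneg]
    exact b.le_one
  · have h1 : gradient (fun x => b ((1 / ((n : ℝ) + 1)) • x)) x
        = (1 / ((n : ℝ) + 1)) • gradient b ((1 / ((n : ℝ) + 1)) • x) := by
      have h2 := (hasFDerivAt_gradient (hb1.differentiable one_ne_zero
        ((1 / ((n : ℝ) + 1)) • x))).comp x ((hasFDerivAt_id x).const_smul (1 / ((n : ℝ) + 1)))
      refine gradient_eq_of_hasFDerivAt h2 fun v => ?_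
      simp [real_inner_smul_left]
    rw [h1, norm_smul, Real.norm_of_nonneg (hpos n).le, mul_comm]
    exact mul_le_mul_of_nonneg_right (hC _) (hpos n).le
  · have h1 : Tendsto (fun n : ℕ => (1 / ((n : ℝ) + 1)) • x) atTop (𝓝 0) := by
      simpa only [zero_smul] using
        (tendsto_one_div_add_atTop_nhds_zero_nat (𝕜 := ℝ)).smul_const x
    have h2 := (hb1.continuous.tendsto 0).comp h1
    rwa [b.one_of_mem_closedBall (Metric.mem_closedBall_self zero_le_one)] at h2

end Cutoff

/-! ### Hardy's inequality for bounded, compactly supported functions. -/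

section HardyCutoff

variable {N : ℕ} {m w h b D χ : Rn N → ℝ} {A B : Rn N → Rn N} {k : ℝ}

theorem gsIntegrand_eq_add (c : ℝ) (g : Rn N) (y m : ℝ) (A B : Rn N) (D s : ℝ) :
    gsIntegrand c g y m A B D s = gsIntegrand c g y m A B D 0 + (c * y) ^ 2 * m * s := by
  unfold gsIntegrand
  ring

/-- Fatou's lemma applied to `q (p n + K) ≥ 0`: the potentials `p n` need only a common lower bound,
since the limit is singular at the origin. -/
theorem integrable_mul_and_integral_le_of_tendsto {α : Type*} [MeasurableSpace α] {ν : Measure α}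
    {Q q P : α → ℝ} {p : ℕ → α → ℝ} {K : ℝ} (hQ : Integrable Q ν) (hq : Integrable q ν)
    (hq0 : ∀ᵐ x ∂ν, 0 ≤ q x) (hp : ∀ n x, -K ≤ p n x)
    (hlim : ∀ᵐ x ∂ν, Tendsto (fun n => p n x) atTop (𝓝 (P x)))
    (hint : ∀ n, Integrable (fun x => Q x - q x * p n x) ν)
    (hnn : ∀ n, 0 ≤ ∫ x, (Q x - q x * p n x) ∂ν) :
    Integrable (fun x => q x * P x) ν ∧ ∫ x, q x * P x ∂ν ≤ ∫ x, Q x ∂ν := by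
  have hP (n : ℕ) : Integrable (fun x => q x * p n x) ν := by
    refine (hQ.sub (hint n)).congr (Eventually.of_forall fun x => ?_)
    simp only [Pi.sub_apply, sub_sub_cancel]
  have hqK := hq.const_mul K
  obtain ⟨h1, h2⟩ := integrable_and_integral_le_of_tendsto
    (f := fun n x => q x * p n x + K * q x) (f₀ := fun x => q x * P x + K * q x)
    (M := fun _ => ∫ x, Q x ∂ν + ∫ x, K * q x ∂ν) (fun n => (hP n).add hqK)
    (fun n => by
      filter_upwards [hq0] with x hx
      nlinarith [hp n x])
    (by
      filter_upwards [hlim] with x hx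
      exact (hx.const_mul _).add_const _)
    (fun n => by
      rw [integral_add (hP n) hqK]
      have h2 := hnn n
      rw [integral_sub hQ (hP n)] at h2
      linarith)
    tendsto_const_nhds
  have h3 : Integrable (fun x => q x * P x) ν := by
    refine (h1.sub hqK).congr (Eventually.of_forall fun x => ?_)
    simp only [Pi.sub_apply, add_sub_cancel_right]
  refine ⟨h3, ?_⟩
  rw [integral_add h3 hqK] at h2
  linarith

/-- The weighted Hardy inequality with remainder for bounded, compactly supported functions. -/
theorem hardy_cutoff (hN : 2 ≤ N) (hm : HasWeakGradient m B) (hD : HasWeakDiv B D)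
    (hw : HasWeakGradient w A) (hm0 : ∀ᵐ x, 0 ≤ m x) (hh : LocallyIntegrable h)
    (hb : LocallyIntegrable b) (hh0 : ∀ᵐ x, 0 ≤ h x) (hb0 : ∀ᵐ x, 0 ≤ b x)
    (hA : ∀ᵐ x, ‖A x‖ ^ 2 ≤ m x * h x) (hB : ∀ᵐ x, ‖B x‖ ^ 2 ≤ m x * b x)
    (hk : ∀ᵐ x, |w x| ≤ k * m x) (hχ : IsTest χ)
    (hi : Integrable fun x => (χ x * (w x / m x)) ^ 2 * m x) :
    Integrable (fun x => gsIntegrand (χ x) (gradient χ x) (w x / m x) (m x) (A x) (B x) (D x) 0) ∧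
    Integrable (fun x => (χ x * (w x / m x)) ^ 2 * m x * hardyPotential N (‖x‖ ^ 2) (‖x‖ ^ 2)) ∧
    ∫ x, (χ x * (w x / m x)) ^ 2 * m x * hardyPotential N (‖x‖ ^ 2) (‖x‖ ^ 2)
      ≤ ∫ x, gsIntegrand (χ x) (gradient χ x) (w x / m x) (m x) (A x) (B x) (D x) 0 := by
  have hd (n : ℕ) : (0 : ℝ) < 1 / ((n : ℝ) + 1) := by positivity
  -- The choice `V = 0` supplies the integrability of the part that does not involve the field.
  have hQ := (integral_gsIntegrand_nonneg hm hD hw hm0 hh hb hh0 hb0 hA hB hk hχ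
    (contDiff_const (c := (0 : Rn N)))).1
  have h0 : divergence (fun _ : Rn N => (0 : Rn N)) = 0 := by
    funext x; simp [divergence]
  simp only [h0, norm_zero, Pi.zero_apply, ne_eq, OfNat.ofNat_ne_zero, not_false_eq_true, zero_pow,
    add_zero] at hQ
  obtain ⟨K, hK0, hK⟩ := exists_hardyPotential_bound hN
  have key (n : ℕ) := integral_gsIntegrand_nonneg hm hD hw hm0 hh hb hh0 hb0 hA hB hk hχ
    (contDiff_hardyField (N := N) (hd n))
  have e (n : ℕ) (x : Rn N) : gsIntegrand (χ x) (gradient χ x) (w x / m x) (m x) (A x) (B x) (D x)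
      (‖hardyField N (1 / ((n : ℝ) + 1)) x‖ ^ 2 + divergence (hardyField N (1 / ((n : ℝ) + 1))) x)
      = gsIntegrand (χ x) (gradient χ x) (w x / m x) (m x) (A x) (B x) (D x) 0
        - (χ x * (w x / m x)) ^ 2 * m x
          * hardyPotential N (‖x‖ ^ 2) (‖x‖ ^ 2 + 1 / ((n : ℝ) + 1)) := by
    rw [gsIntegrand_eq_add, norm_sq_add_divergence_hardyField (hd n)]
    ring
  simp only [e] at key
  have : Nontrivial (Rn N) := by
    have : Nonempty (Fin N) := ⟨⟨0, by omega⟩⟩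
    infer_instance
  have hne : ∀ᵐ x : Rn N, x ≠ 0 := by
    simp [ae_iff]
  refine ⟨hQ, integrable_mul_and_integral_le_of_tendsto hQ hi (K := K)
    (p := fun n x => hardyPotential N (‖x‖ ^ 2) (‖x‖ ^ 2 + 1 / ((n : ℝ) + 1))) ?_ (fun n x => ?_) ?_
    (fun n => (key n).1) (fun n => (key n).2)⟩
  · filter_upwards [hm0] with x hx
    positivity
  · have := hd n
    exact hK (‖x‖ ^ 2) (‖x‖ ^ 2 + 1 / ((n : ℝ) + 1)) (by positivity) (by linarith) (by positivity)
  · filter_upwards [hne] with x hx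
    exact tendsto_hardyPotential (N := N) (r := ‖x‖ ^ 2) (by positivity)

end HardyCutoff

/-! ### Removal of the truncation and of the cutoff. -/

section WeightedInequality

variable {N : ℕ} {μ D b φ : Rn N → ℝ} {B F : Rn N → Rn N}

/-- The cross term is split as `2 e p ‖f‖ ≤ e (p² + ‖f‖²)`, so that the gradient term has
coefficient tending to exactly `1` as `e → 0`. -/
theorem norm_add_sq_le_of_le {a f : Rn N} {e p : ℝ} (he : 0 ≤ e) (ha : ‖a‖ ≤ e * p) :
    ‖a + f‖ ^ 2 ≤ (1 + e) * ‖f‖ ^ 2 + (e + e ^ 2) * p ^ 2 := by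
  have h1 : ‖a + f‖ ≤ e * p + ‖f‖ := (norm_add_le _ _).trans (by linarith)
  have h2 : ‖a + f‖ ^ 2 ≤ (e * p + ‖f‖) ^ 2 := pow_le_pow_left₀ (norm_nonneg _) h1 2
  nlinarith [mul_nonneg he (sq_nonneg (p - ‖f‖))]

/-- The weighted Hardy inequality for truncated functions. -/
theorem hardy_trunc (hN : 2 ≤ N) (hm : HasWeakGradient μ B) (hD : HasWeakDiv B D)
    (hm0 : ∀ᵐ x, 0 ≤ μ x) (hb : LocallyIntegrable b) (hb0 : ∀ᵐ x, 0 ≤ b x)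
    (hB : ∀ᵐ x, ‖B x‖ ^ 2 ≤ μ x * b x)
    (hw : HasWeakGradient (fun x => φ x * μ x) (fun x => μ x • F x + φ x • B x))
    (mφ : AEMeasurable φ) (mF : AEMeasurable F)
    (iφ : Integrable fun x => μ x * φ x ^ 2) (iF : Integrable fun x => μ x * ‖F x‖ ^ 2)
    {c C : ℝ} (hc : 0 ≤ c) (hC : 0 ≤ C)
    (hpot : ∀ᵐ x, 0 < μ x → c / ‖x‖ ^ 2 ≤ hardyPotential N (‖x‖ ^ 2) (‖x‖ ^ 2)
      - (1 / 4 * ‖(μ x)⁻¹ • B x‖ ^ 2 - 1 / 2 * (D x / μ x)) + C)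
    {k e : ℝ} (hk : 1 ≤ k) (he : 0 ≤ e) {χ : Rn N → ℝ} (hχ : IsTest χ) (hχ1 : ∀ x, |χ x| ≤ 1)
    (hχe : ∀ x, ‖gradient χ x‖ ≤ e) :
    Integrable (fun x => μ x * ((χ x * trunc k (φ x)) ^ 2 * (c / ‖x‖ ^ 2))) ∧
    ∫ x, μ x * ((χ x * trunc k (φ x)) ^ 2 * (c / ‖x‖ ^ 2)) ≤
      (1 + e) * (∫ x, μ x * ‖F x‖ ^ 2) + (e + e ^ 2 + C) * ∫ x, μ x * φ x ^ 2 := by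
  have hBz : ∀ᵐ x, μ x = 0 → B x = 0 := by
    filter_upwards [hB] with x h1 h2
    rw [h2, zero_mul] at h1
    simpa using le_antisymm h1 (sq_nonneg _)
  have mμ : AEMeasurable μ := hm.1.aestronglyMeasurable.aemeasurable
  have mT : AEMeasurable fun x => trunc k (φ x) :=
    (contDiff_trunc hk).continuous.measurable.comp_aemeasurable mφ
  have mT' : AEMeasurable fun x => deriv (trunc k) (φ x) :=
    ((contDiff_trunc hk).continuous_deriv le_rfl).measurable.comp_aemeasurable mφ
  have hχc : Continuous χ := hχ.1.continuous
  have hgc : Continuous (gradient χ) := gradient_continuous (hχ.1.of_le (by simp))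
  have hw1 := hm.mul_comp_div hw hm0 (by
    filter_upwards [hBz] with x hx h0
    simp [hx h0, h0]) (contDiff_trunc hk) (abs_trunc_le hk)
    (fun y => (abs_deriv_trunc_le_one hk y).trans hk) (abs_mul_deriv_trunc_le hk)
  set w₁ : Rn N → ℝ := fun x => μ x * trunc k (φ x * μ x / μ x) with hw₁
  set A₁ : Rn N → Rn N := fun x => deriv (trunc k) (φ x * μ x / μ x) • (μ x • F x + φ x • B x)
    + (trunc k (φ x * μ x / μ x) - φ x * μ x / μ x * deriv (trunc k) (φ x * μ x / μ x)) • B x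
    with hA₁
  have hy : ∀ x, 0 < μ x → w₁ x / μ x = trunc k (φ x) := fun x hx => by
    rw [hw₁]
    dsimp only
    rw [mul_div_cancel_right₀ _ hx.ne', mul_div_cancel_left₀ _ hx.ne']
  -- The terms `φ T'(φ) B` cancel, where `T` is the truncation; what remains multiplies `B` only by
  -- the bounded function `T(φ)`.
  have hAp : ∀ x, 0 < μ x →
      A₁ x = (deriv (trunc k) (φ x) * μ x) • F x + trunc k (φ x) • B x := fun x hx => by
    rw [hA₁]
    dsimp only
    rw [mul_div_cancel_right₀ _ hx.ne']
    module
  have hA1 : ∀ᵐ x, ‖A₁ x‖ ^ 2 ≤ μ x * (2 * (μ x * ‖F x‖ ^ 2) + 2 * k ^ 2 * b x) := by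
    filter_upwards [hm0, hB, hBz] with x h0 h1 h2
    rcases h0.eq_or_lt with hx | hx
    · simp [hA₁, h2 hx.symm, ← hx]
    · rw [hAp x hx]
      have h3 := abs_deriv_trunc_le_one hk (φ x)
      have h4 := abs_trunc_le hk (φ x)
      have e1 : ‖(deriv (trunc k) (φ x) * μ x) • F x‖ ≤ μ x * ‖F x‖ := by
        rw [norm_smul, norm_mul, Real.norm_of_nonneg h0, Real.norm_eq_abs]
        have : 0 ≤ μ x * ‖F x‖ := by positivity
        nlinarith
      have e2 : ‖trunc k (φ x) • B x‖ ≤ k * ‖B x‖ := by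
        rw [norm_smul]; exact mul_le_mul_of_nonneg_right h4 (norm_nonneg _)
      have e3 := (norm_add_le _ _).trans (add_le_add e1 e2)
      have e4 := pow_le_pow_left₀ (norm_nonneg _) e3 2
      have e5 : k ^ 2 * ‖B x‖ ^ 2 ≤ k ^ 2 * (μ x * b x) :=
        mul_le_mul_of_nonneg_left h1 (sq_nonneg _)
      nlinarith [sq_nonneg (μ x * ‖F x‖ - k * ‖B x‖)]
  have hk1 : ∀ᵐ x, |w₁ x| ≤ k * μ x := by
    filter_upwards [hm0] with x h0
    rw [hw₁, abs_mul, abs_of_nonneg h0, mul_comm]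
    exact mul_le_mul_of_nonneg_right (abs_trunc_le hk _) h0
  have hq : (fun x => μ x * (χ x * trunc k (φ x)) ^ 2)
      =ᵐ[volume] fun x => (χ x * (w₁ x / μ x)) ^ 2 * μ x := by
    filter_upwards [hm0] with x h0
    rcases h0.eq_or_lt with hx | hx
    · simp [← hx]
    · rw [hy x hx, mul_comm]
  have hqφ : ∀ᵐ x, μ x * (χ x * trunc k (φ x)) ^ 2 ≤ μ x * φ x ^ 2 := by
    filter_upwards [hm0] with x h0
    refine mul_le_mul_of_nonneg_left (sq_le_sq.2 ?_) h0
    rw [abs_mul]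
    have := abs_trunc_le_abs hk (φ x)
    nlinarith [hχ1 x, abs_nonneg (χ x), abs_nonneg (φ x), abs_nonneg (trunc k (φ x))]
  have iq : Integrable fun x => μ x * (χ x * trunc k (φ x)) ^ 2 := by
    refine iφ.mono' (mμ.mul ((hχc.aemeasurable.mul mT).pow_const 2)).aestronglyMeasurable ?_
    filter_upwards [hm0, hqφ] with x h0 h1
    rwa [Real.norm_of_nonneg (by positivity)]
  have hEb : ∀ᵐ x,
      μ x * ‖trunc k (φ x) • gradient χ x + (χ x * deriv (trunc k) (φ x)) • F x‖ ^ 2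
      ≤ (1 + e) * (μ x * ‖F x‖ ^ 2) + (e + e ^ 2) * (μ x * φ x ^ 2) := by
    filter_upwards [hm0] with x h0
    have h1 : ‖trunc k (φ x) • gradient χ x‖ ≤ e * |φ x| := by
      rw [norm_smul, mul_comm]
      exact mul_le_mul (hχe x) (abs_trunc_le_abs hk _) (norm_nonneg _) he
    have h2 : ‖(χ x * deriv (trunc k) (φ x)) • F x‖ ≤ ‖F x‖ := by
      rw [norm_smul, norm_mul]
      refine mul_le_of_le_one_left (norm_nonneg _) ?_
      exact mul_le_one₀ (hχ1 x) (norm_nonneg _) (abs_deriv_trunc_le_one hk _)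
    have h3 := norm_add_sq_le_of_le (f := (χ x * deriv (trunc k) (φ x)) • F x) he h1
    have h4 := pow_le_pow_left₀ (norm_nonneg _) h2 2
    rw [sq_abs] at h3
    have h5 : (1 + e) * ‖(χ x * deriv (trunc k) (φ x)) • F x‖ ^ 2 ≤ (1 + e) * ‖F x‖ ^ 2 :=
      mul_le_mul_of_nonneg_left h4 (by linarith)
    have h6 := mul_le_mul_of_nonneg_left (h3.trans (add_le_add_left h5 _)) h0
    linarith
  have iR := (iF.const_mul (1 + e)).add (iφ.const_mul (e + e ^ 2))
  have iE : Integrable fun x =>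
      μ x * ‖trunc k (φ x) • gradient χ x + (χ x * deriv (trunc k) (φ x)) • F x‖ ^ 2 := by
    refine iR.mono' (mμ.mul
      (((mT.smul hgc.aemeasurable).add ((hχc.aemeasurable.mul mT').smul
        mF)).norm.pow_const 2)).aestronglyMeasurable ?_
    filter_upwards [hm0, hEb] with x h0 h1
    rwa [Real.norm_of_nonneg (by positivity)]
  have hE : ∫ x, μ x * ‖trunc k (φ x) • gradient χ x + (χ x * deriv (trunc k) (φ x)) • F x‖ ^ 2
      ≤ (1 + e) * (∫ x, μ x * ‖F x‖ ^ 2) + (e + e ^ 2) * ∫ x, μ x * φ x ^ 2 := by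
    rw [← integral_const_mul, ← integral_const_mul,
      ← integral_add (iF.const_mul (1 + e)) (iφ.const_mul (e + e ^ 2))]
    exact integral_mono_ae iE iR hEb
  obtain ⟨iQ, iP, hle⟩ := hardy_cutoff hN hm hD hw1 hm0
    (locallyIntegrable_add (locallyIntegrable_const_mul 2 iF.locallyIntegrable)
      (locallyIntegrable_const_mul (2 * k ^ 2) hb)) hb
    (by filter_upwards [hm0, hb0] with x h0 h1; positivity) hb0 hA1 hB hk1 hχ (iq.congr hq)
  -- Where `μ > 0` the ground state integrand equals the energy density of `χ T(φ)` plus `U_μ` times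
  -- `μ (χ T(φ))²`, so `hpot` applies pointwise. Its difference with the Hardy term is kept together
  -- because `U_μ` alone has no two-sided bound.
  have hfin : ∀ᵐ x, μ x * ((χ x * trunc k (φ x)) ^ 2 * (c / ‖x‖ ^ 2)) ≤
      ((χ x * (w₁ x / μ x)) ^ 2 * μ x * hardyPotential N (‖x‖ ^ 2) (‖x‖ ^ 2)
        - gsIntegrand (χ x) (gradient χ x) (w₁ x / μ x) (μ x) (A₁ x) (B x) (D x) 0)
      + (μ x * ‖trunc k (φ x) • gradient χ x + (χ x * deriv (trunc k) (φ x)) • F x‖ ^ 2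
        + C * (μ x * (χ x * trunc k (φ x)) ^ 2)) := by
    filter_upwards [hm0, hpot] with x h0 h1
    rcases h0.eq_or_lt with hx | hx
    · simp [← hx, gsIntegrand]
    · have hQ : gsIntegrand (χ x) (gradient χ x) (w₁ x / μ x) (μ x) (A₁ x) (B x) (D x) 0
          = μ x * ‖trunc k (φ x) • gradient χ x + (χ x * deriv (trunc k) (φ x)) • F x‖ ^ 2
          + μ x * (χ x * trunc k (φ x)) ^ 2
            * (1 / 4 * ‖(μ x)⁻¹ • B x‖ ^ 2 - 1 / 2 * (D x / μ x)) := by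
        rw [hy x hx, hAp x hx, gsIntegrand]
        have : trunc k (φ x) • gradient χ x + (χ x / μ x) •
            ((deriv (trunc k) (φ x) * μ x) • F x + trunc k (φ x) • B x - trunc k (φ x) • B x)
            = trunc k (φ x) • gradient χ x + (χ x * deriv (trunc k) (φ x)) • F x := by
          rw [add_sub_cancel_right, smul_smul]
          congr 2
          field_simp
        rw [this, norm_smul (μ x)⁻¹, norm_inv, Real.norm_of_nonneg h0]
        field_simp
        ring
      rw [hQ, hy x hx]
      have h2 := mul_le_mul_of_nonneg_left (h1 hx)
        (show 0 ≤ μ x * (χ x * trunc k (φ x)) ^ 2 by positivity)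
      linarith
  have mg : AEStronglyMeasurable fun x => μ x * ((χ x * trunc k (φ x)) ^ 2 * (c / ‖x‖ ^ 2)) :=
    (mμ.mul (((hχc.aemeasurable.mul mT).pow_const 2).mul
      ((measurable_norm.pow_const 2).const_div c).aemeasurable)).aestronglyMeasurable
  have irhs := (iP.sub iQ).add (iE.add (iq.const_mul C))
  have hg0 : ∀ᵐ x, 0 ≤ μ x * ((χ x * trunc k (φ x)) ^ 2 * (c / ‖x‖ ^ 2)) := by
    filter_upwards [hm0] with x h0
    positivity
  have ig : Integrable fun x => μ x * ((χ x * trunc k (φ x)) ^ 2 * (c / ‖x‖ ^ 2)) := by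
    refine irhs.mono' mg ?_
    filter_upwards [hg0, hfin] with x h0 h1
    rw [Real.norm_of_nonneg h0]
    exact h1
  refine ⟨ig, ?_⟩
  have hmono := integral_mono_ae ig irhs hfin
  have hsplit := integral_add (iP.sub iQ) (iE.add (iq.const_mul C))
  have hsplit1 := integral_sub iP iQ
  have hsplit2 := integral_add iE (iq.const_mul C)
  have hq2 : ∫ x, μ x * (χ x * trunc k (φ x)) ^ 2 ≤ ∫ x, μ x * φ x ^ 2 :=
    integral_mono_ae iq iφ hqφ
  have hC2 := mul_le_mul_of_nonneg_left hq2 hC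
  rw [integral_const_mul] at hsplit2
  simp only [Pi.add_apply, Pi.sub_apply] at hmono hsplit hsplit1 hsplit2
  linarith

/-- The weighted Hardy inequality, in terms of Lebesgue integrals. -/
theorem hardy_of_potential_le (hN : 2 ≤ N) (hm : HasWeakGradient μ B) (hD : HasWeakDiv B D)
    (hm0 : ∀ᵐ x, 0 ≤ μ x) (hb : LocallyIntegrable b) (hb0 : ∀ᵐ x, 0 ≤ b x)
    (hB : ∀ᵐ x, ‖B x‖ ^ 2 ≤ μ x * b x)
    (hw : HasWeakGradient (fun x => φ x * μ x) (fun x => μ x • F x + φ x • B x))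
    (mφ : AEMeasurable φ) (mF : AEMeasurable F)
    (iφ : Integrable fun x => μ x * φ x ^ 2) (iF : Integrable fun x => μ x * ‖F x‖ ^ 2)
    {c C : ℝ} (hc : 0 ≤ c) (hC : 0 ≤ C)
    (hpot : ∀ᵐ x, 0 < μ x → c / ‖x‖ ^ 2 ≤ hardyPotential N (‖x‖ ^ 2) (‖x‖ ^ 2)
      - (1 / 4 * ‖(μ x)⁻¹ • B x‖ ^ 2 - 1 / 2 * (D x / μ x)) + C) :
    Integrable (fun x => μ x * (φ x ^ 2 * (c / ‖x‖ ^ 2))) ∧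
    ∫ x, μ x * (φ x ^ 2 * (c / ‖x‖ ^ 2)) ≤
      (∫ x, μ x * ‖F x‖ ^ 2) + C * ∫ x, μ x * φ x ^ 2 := by
  obtain ⟨χ, C₀, hC₀, hχ, hχ1, hχe, hχlim⟩ := exists_cutoff N
  have key (n : ℕ) := hardy_trunc hN hm hD hm0 hb hb0 hB hw mφ mF iφ iF hc hC hpot
    (k := (n : ℝ) + 1) (e := C₀ * (1 / ((n : ℝ) + 1))) (by simp) (by positivity) (hχ n) (hχ1 n)
    (hχe n)
  refine integrable_and_integral_le_of_tendsto (fun n => (key n).1) (fun n => ?_) ?_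
    (fun n => (key n).2) ?_
  · filter_upwards [hm0] with x h0
    positivity
  · refine Eventually.of_forall fun x => ?_
    have h1 := (((hχlim x).mul (tendsto_trunc (φ x))).pow 2).mul_const (c / ‖x‖ ^ 2)
    rw [one_mul] at h1
    exact h1.const_mul (μ x)
  · have he : Tendsto (fun n : ℕ => C₀ * (1 / ((n : ℝ) + 1))) atTop (𝓝 0) := by
      simpa only [mul_zero] using (tendsto_one_div_add_atTop_nhds_zero_nat (𝕜 := ℝ)).const_mul C₀
    have h1 := ((he.const_add 1).mul_const (∫ x, μ x * ‖F x‖ ^ 2)).add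
      (((he.add (he.pow 2)).add_const C).mul_const (∫ x, μ x * φ x ^ 2))
    simpa only [add_zero, one_mul, zero_add, ne_eq, OfNat.ofNat_ne_zero, not_false_eq_true,
      zero_pow] using h1

end WeightedInequality

/-! ### Passage between `dμ` and Lebesgue measure; regularity of the density. -/

section Density

variable {N : ℕ} {μ : Rn N → ℝ} {E : Type*} [NormedAddCommGroup E] [NormedSpace ℝ E]

theorem toReal_ofReal_ae (h0 : ∀ᵐ x, 0 ≤ μ x) :
    ∀ᵐ x, (ENNReal.ofReal (μ x)).toReal = μ x := by
  filter_upwards [h0] with x hx using ENNReal.toReal_ofReal hx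

theorem integral_dens (hμ : AEMeasurable μ) (h0 : ∀ᵐ x, 0 ≤ μ x) (f : Rn N → E) :
    ∫ x, f x ∂(dens μ) = ∫ x, μ x • f x := by
  rw [dens, integral_withDensity_eq_integral_toReal_smul₀ hμ.ennreal_ofReal (by simp)]
  refine integral_congr_ae ?_
  filter_upwards [toReal_ofReal_ae h0] with x hx
  rw [hx]

theorem integrable_dens_iff (hμ : AEMeasurable μ) (h0 : ∀ᵐ x, 0 ≤ μ x) {f : Rn N → E} :
    Integrable f (dens μ) ↔ Integrable fun x => μ x • f x := by
  rw [dens, integrable_withDensity_iff_integrable_smul₀' hμ.ennreal_ofReal (by simp)]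
  refine integrable_congr ?_
  filter_upwards [toReal_ofReal_ae h0] with x hx
  rw [hx]

theorem ae_dens_iff (hμ : AEMeasurable μ) {p : Rn N → Prop} :
    (∀ᵐ x ∂(dens μ), p x) ↔ ∀ᵐ x, 0 < μ x → p x := by
  rw [dens, ae_withDensity_iff' hμ.ennreal_ofReal]
  simp [ENNReal.ofReal_eq_zero]

theorem HasWeakGradient.congr {f f' : Rn N → ℝ} {G G' : Rn N → Rn N} (h : HasWeakGradient f G)
    (hf : f =ᵐ[volume] f') (hG : G =ᵐ[volume] G') : HasWeakGradient f' G' := by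
  refine ⟨h.1.congr hf, h.2.1.congr hG, fun η hη => ?_⟩
  have h1 : ∫ x, f' x • gradient η x = ∫ x, f x • gradient η x :=
    integral_congr_ae (by filter_upwards [hf] with x hx; rw [hx])
  have h2 : ∫ x, η x • G' x = ∫ x, η x • G x :=
    integral_congr_ae (by filter_upwards [hG] with x hx; rw [hx])
  rw [h1, h2, h.2.2 η hη]

theorem locallyIntegrable_norm_sq {V : Type*} [NormedAddCommGroup V] {f : Rn N → V}
    (h : ∀ K : Set (Rn N), IsCompact K → MemLp f 2 (volume.restrict K)) :
    LocallyIntegrable fun x => ‖f x‖ ^ 2 := by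
  rw [locallyIntegrable_iff]
  intro K hK
  exact (memLp_two_iff_integrable_sq_norm (h K hK).1).1 (h K hK)

/-- A density with `μ ^ (1 / 2) ∈ H¹_loc` is weakly differentiable, and `|∇μ|² / μ` is locally
integrable. -/
theorem exists_weakGradient_bound (h0 : ∀ᵐ x, 0 ≤ μ x) (h : MemH1Loc fun x => √(μ x)) :
    HasWeakGradient μ (weakGradient μ) ∧ ∃ b : Rn N → ℝ, LocallyIntegrable b ∧
      (∀ᵐ x, 0 ≤ b x) ∧ ∀ᵐ x, ‖weakGradient μ x‖ ^ 2 ≤ μ x * b x := by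
  obtain ⟨G, hG, hK⟩ := h
  have iG := locallyIntegrable_norm_sq fun K hK' => (hK K hK').2
  have h1 := hG.sq (locallyIntegrable_norm_sq fun K hK' => (hK K hK').1) iG
  have h2 : HasWeakGradient μ fun x => (2 * √(μ x)) • G x := h1.congr (by
    filter_upwards [h0] with x hx using Real.sq_sqrt hx) (by rfl)
  have h3 := hasWeakGradient_weakGradient ⟨_, h2⟩
  -- From `∇μ = 2 √μ ∇√μ` one reads off `|∇μ|² = μ * 4 |∇√μ|²`.
  refine ⟨h3, fun x => 4 * ‖G x‖ ^ 2, locallyIntegrable_const_mul 4 iG,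
    Eventually.of_forall fun x => by positivity, ?_⟩
  filter_upwards [h3.ae_eq h2, h0] with x hx hx0
  rw [hx, norm_smul, mul_pow, norm_mul, mul_pow, Real.norm_eq_abs √(μ x), sq_abs, Real.sq_sqrt hx0]
  norm_num
  linarith

end Density

/-! ### Comparison of the Hardy potential with `U_μ`. -/

section Potential

variable {N : ℕ} {μ : Rn N → ℝ}

/-- A lower limit of `c₀ - f` is `c₀` minus the upper limit of `f`. Finiteness of `c_{0,μ}` rules
out the infinite values that would spoil the passage to real numbers. -/
theorem toReal_c₀μ_le (h : c₀μ μ ≠ ⊥ ∧ c₀μ μ ≠ ⊤) :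
    (c₀μ μ).toReal ≤ c₀ N - (limsupU μ).toReal := by
  -- If `μ` vanished almost everywhere near `0`, the lower limit would be taken along the trivial
  -- filter and equal `⊤`.
  have hne : (nearZero μ).NeBot := by
    refine ⟨fun hbot => h.2 ?_⟩
    rw [c₀μ, hbot, liminf_bot]
  have hc : ((c₀μ μ).toReal : EReal) = c₀μ μ := EReal.coe_toReal h.2 h.1
  set g : Rn N → EReal := fun x => ((c₀ N - ‖x‖ ^ 2 * Uμ μ x : ℝ) : EReal) with hg
  set f : Rn N → EReal := fun x => ((‖x‖ ^ 2 * Uμ μ x : ℝ) : EReal) with hf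
  have hfg : f = (fun _ => (c₀ N : EReal)) + (-g) := by
    funext x
    simp only [hf, hg, Pi.add_apply, Pi.neg_apply]
    rw [← EReal.coe_neg, ← EReal.coe_add]
    congr 1
    ring
  have hgf : g = (fun _ => (c₀ N : EReal)) + (-f) := by
    funext x
    simp only [hf, hg, Pi.add_apply, Pi.neg_apply]
    rw [← EReal.coe_neg, ← EReal.coe_add]
    congr 1
  have hcg : c₀μ μ = liminf g (nearZero μ) := rfl
  have hLf : limsupU μ = limsup f (nearZero μ) := rfl
  have h1 : limsupU μ ≤ ((c₀ N - (c₀μ μ).toReal : ℝ) : EReal) := by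
    rw [hLf]
    conv_lhs => rw [hfg]
    refine (EReal.limsup_add_le (by simp) (by simp)).trans ?_
    rw [EReal.limsup_neg, ← hcg, limsup_const, ← hc, ← EReal.coe_neg, ← EReal.coe_add]
    simp [sub_eq_add_neg]
  -- Otherwise `toReal` would return the default value `0`; but an upper limit `⊥` would force
  -- `c_{0,μ} = ⊤`.
  have h2 : limsupU μ ≠ ⊥ := by
    intro hbot
    apply h.2
    rw [hcg]
    have h3 : liminf (fun _ => (c₀ N : EReal)) (nearZero μ) + liminf (-f) (nearZero μ)
        ≤ liminf g (nearZero μ) := by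
      conv_rhs => rw [hgf]
      exact EReal.le_liminf_add
    rw [EReal.liminf_neg, ← hLf, hbot, liminf_const, EReal.neg_bot, EReal.coe_add_top] at h3
    exact top_le_iff.1 h3
  have h3 := EReal.toReal_le_toReal h1 h2 (EReal.coe_ne_top _)
  rw [EReal.toReal_coe] at h3
  linarith

/-- Passing from the variable `s = |x|²` to `|x|` produces the constant `1 / 4` of hypothesis (iv).
-/
theorem inv_log_sq {r : ℝ} : (Real.log (r ^ 2))⁻¹ ^ 2 = 1 / 4 * (1 / |Real.log r| ^ 2) := by
  rw [Real.log_pow, sq_abs, inv_pow]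
  push_cast
  rw [mul_pow, mul_inv]
  norm_num

theorem exists_potential_bound (hN : 2 ≤ N) (hμ : HypH2 μ) (mμ : AEMeasurable μ)
    (hc : 0 ≤ (c₀μ μ).toReal) :
    ∃ C : ℝ, 0 ≤ C ∧ ∀ᵐ x, 0 < μ x → (c₀μ μ).toReal / ‖x‖ ^ 2 ≤
      hardyPotential N (‖x‖ ^ 2) (‖x‖ ^ 2) - Uμ μ x + C := by
  obtain ⟨R₀, hR₀, hlog⟩ := hμ.log_bound
  have hcL := toReal_c₀μ_le hμ.finite
  set c := (c₀μ μ).toReal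
  set L := (limsupU μ).toReal with hL
  -- Inside this ball `|x|² < 1 / 4`, where the profile is not cut off, and the logarithmic bound on
  -- `U` holds.
  set r := min R₀ (1 / 2) with hr
  have hr0 : 0 < r := lt_min hR₀ (by norm_num)
  obtain ⟨K', hK'⟩ := hμ.bounded r hr0
  obtain ⟨K, hK0, hK⟩ := exists_hardyPotential_bound hN
  -- The constant is needed only for `|x| ≥ r`: `K` bounds the Hardy potential from below, `K'`
  -- bounds `U` from above, and the last term covers the inverse-square terms.
  refine ⟨K + |K'| + (|L| + c) / r ^ 2, by positivity, ?_⟩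
  have : Nontrivial (Rn N) := by
    have : Nonempty (Fin N) := ⟨⟨0, by omega⟩⟩
    infer_instance
  have hne : ∀ᵐ x : Rn N, x ≠ 0 := by
    simp [ae_iff]
  filter_upwards [(ae_dens_iff mμ).1 hlog, (ae_dens_iff mμ).1 hK', hne] with x h1 h2 h3 hx
  have hx0 : 0 < ‖x‖ := norm_pos_iff.2 h3
  have hU : Uμ μ x = U μ x + 1 / ‖x‖ ^ 2 * L := by rw [U]; ring
  rcases lt_or_ge ‖x‖ r with hlt | hge
  · have h4 := h1 hx (hlt.trans_le (min_le_left _ _))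
    have hlt2 : ‖x‖ < 1 / 2 := hlt.trans_le (min_le_right _ _)
    rw [hardyPotential_self (by positivity) (by nlinarith), inv_log_sq, hU]
    have h5 : U μ x ≤ (1 / 4 * (1 / |Real.log ‖x‖| ^ 2)) / ‖x‖ ^ 2 := by
      rw [le_div_iff₀ (by positivity)]; linarith
    have h6 : c / ‖x‖ ^ 2 ≤ (c₀ N - L) / ‖x‖ ^ 2 := by gcongr
    have h7 : 0 ≤ K + |K'| + (|L| + c) / r ^ 2 := by positivity
    rw [add_div]
    rw [sub_div] at h6
    have h8 : 1 / ‖x‖ ^ 2 * L = L / ‖x‖ ^ 2 := by ring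
    linarith
  · have h4 := h2 hx hge
    have h5 := hK (‖x‖ ^ 2) (‖x‖ ^ 2) (by positivity) le_rfl (by positivity)
    have h6 : c / ‖x‖ ^ 2 ≤ c / r ^ 2 := by gcongr
    have h7 : 1 / ‖x‖ ^ 2 * L ≤ |L| / r ^ 2 := by
      rw [one_div_mul_eq_div]
      exact (div_le_div_of_nonneg_right (le_abs_self L) (by positivity)).trans (by gcongr)
    have h8 := le_abs_self K'
    rw [hU, add_div]
    linarith

end Potential

/-! ### Functions in `H¹_μ` and the final inequality. -/

section Sobolev

variable {N : ℕ} {μ b φ : Rn N → ℝ} {F : Rn N → Rn N}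

theorem MemH1μ.congr {φ' : Rn N → ℝ} {F' : Rn N → Rn N} (h : MemH1μ μ φ F)
    (hφ : φ =ᵐ[dens μ] φ') (hF : F =ᵐ[dens μ] F') : MemH1μ μ φ' F' := by
  refine ⟨h.memLp.ae_eq hφ, h.memLp_grad.ae_eq hF, fun η hη => ?_⟩
  have h1 : ∫ x, η x • F' x ∂(dens μ) = ∫ x, η x • F x ∂(dens μ) :=
    integral_congr_ae (by filter_upwards [hF] with x hx; rw [hx])
  have h2 : ∫ x, φ' x • gradient η x ∂(dens μ) = ∫ x, φ x • gradient η x ∂(dens μ) :=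
    integral_congr_ae (by filter_upwards [hφ] with x hx; rw [hx])
  have h3 : ∫ x, (φ' x * η x) • logGradient μ x ∂(dens μ)
      = ∫ x, (φ x * η x) • logGradient μ x ∂(dens μ) :=
    integral_congr_ae (by filter_upwards [hφ] with x hx; rw [hx])
  rw [h1, h2, h3, h.weak η hη]

/-- For `φ ∈ H¹_μ` the product `φ μ` is weakly differentiable with respect to Lebesgue measure. -/
theorem MemH1μ.hasWeakGradient (h : MemH1μ μ φ F) (h0 : ∀ᵐ x, 0 ≤ μ x)
    (hm : HasWeakGradient μ (weakGradient μ)) (hb : LocallyIntegrable b) (hb0 : ∀ᵐ x, 0 ≤ b x)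
    (hB : ∀ᵐ x, ‖weakGradient μ x‖ ^ 2 ≤ μ x * b x) (mφ : AEMeasurable φ) (mF : AEMeasurable F)
    (iφ : Integrable fun x => μ x * φ x ^ 2) (iF : Integrable fun x => μ x * ‖F x‖ ^ 2) :
    HasWeakGradient (fun x => φ x * μ x) (fun x => μ x • F x + φ x • weakGradient μ x) := by
  have mμ : AEMeasurable μ := hm.1.aestronglyMeasurable.aemeasurable
  have mB : AEMeasurable (weakGradient μ) := hm.2.1.aestronglyMeasurable.aemeasurable
  have i1 : LocallyIntegrable fun x => φ x * μ x := by
    refine locallyIntegrable_of_norm_le (locallyIntegrable_add iφ.locallyIntegrable hm.1)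
      (mφ.mul mμ).aestronglyMeasurable ?_
    filter_upwards [h0] with x hx
    rw [norm_mul, Real.norm_of_nonneg hx,
      Real.norm_of_nonneg (by positivity : 0 ≤ μ x * φ x ^ 2 + μ x), Real.norm_eq_abs,
      ← sq_abs (φ x)]
    nlinarith [mul_nonneg hx (sq_nonneg (|φ x| - 1)), mul_nonneg hx (abs_nonneg (φ x))]
  have i2 : LocallyIntegrable fun x => μ x • F x := by
    refine locallyIntegrable_of_norm_le (locallyIntegrable_add iF.locallyIntegrable hm.1)
      (mμ.smul mF).aestronglyMeasurable ?_
    filter_upwards [h0] with x hx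
    rw [norm_smul, Real.norm_of_nonneg hx, Real.norm_of_nonneg (by positivity)]
    nlinarith [mul_nonneg hx (sq_nonneg (‖F x‖ - 1)), mul_nonneg hx (norm_nonneg (F x))]
  have i3 : LocallyIntegrable fun x => φ x • weakGradient μ x := by
    refine locallyIntegrable_of_norm_le (locallyIntegrable_add iφ.locallyIntegrable hb)
      (mφ.smul mB).aestronglyMeasurable ?_
    filter_upwards [h0, hb0, hB] with x hx h1 h2
    rw [Real.norm_of_nonneg (by positivity)]
    -- Here `φ² |∇μ|² ≤ (μ φ²) b`, and the geometric mean of `μ φ²` and `b` is at most their sum.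
    refine le_of_sq_le_sq ?_ (by positivity)
    rw [norm_smul, mul_pow, Real.norm_eq_abs, sq_abs]
    have h3 := mul_le_mul_of_nonneg_left h2 (sq_nonneg (φ x))
    have h4 : 0 ≤ μ x * φ x ^ 2 := by positivity
    nlinarith [sq_nonneg (μ x * φ x ^ 2 - b x)]
  refine ⟨i1, locallyIntegrable_add i2 i3, fun η hη => ?_⟩
  have h1 := h.weak η hη
  rw [integral_dens mμ h0, integral_dens mμ h0, integral_dens mμ h0] at h1
  have j2 : Integrable fun x => η x • (μ x • F x) :=
    i2.integrable_smul_left_of_hasCompactSupport hη.1.continuous hη.2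
  have j3 : Integrable fun x => η x • (φ x • weakGradient μ x) :=
    i3.integrable_smul_left_of_hasCompactSupport hη.1.continuous hη.2
  simp only [smul_add]
  rw [integral_add j2 j3]
  have e1 : ∫ x, μ x • η x • F x = ∫ x, η x • (μ x • F x) :=
    integral_congr_ae (Eventually.of_forall fun x => smul_comm _ _ _)
  have e2 : ∫ x, μ x • φ x • gradient η x = ∫ x, (φ x * μ x) • gradient η x :=
    integral_congr_ae (Eventually.of_forall fun x => by
      dsimp only
      rw [smul_smul, mul_comm])
  have e3 : ∫ x, μ x • (φ x * η x) • logGradient μ x = ∫ x, η x • (φ x • weakGradient μ x) := by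
    refine integral_congr_ae ?_
    filter_upwards [hB] with x hx
    -- On the zero set of `μ` the logarithmic gradient is meaningless, but there `∇μ = 0` as well,
    -- so nothing is lost.
    rcases eq_or_ne (μ x) 0 with hz | hz
    · have : weakGradient μ x = 0 := by
        rw [hz, zero_mul] at hx
        simpa using le_antisymm hx (sq_nonneg _)
      simp [hz, this]
    · rw [logGradient, smul_smul, smul_smul, smul_smul]
      congr 1
      field_simp
  rw [e1, e2, e3] at h1
  rw [h1]
  abel

/-- The weighted Hardy inequality under Hypothesis (H2), for a positive constant. -/
theorem HypH2.exists_hardy (hN : 2 ≤ N) (hμ : HypH2 μ) (hc : 0 < (c₀μ μ).toReal) :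
    ∃ C : ℝ, ∀ (φ : Rn N → ℝ) (F : Rn N → Rn N), MemH1μ μ φ F →
      Integrable (fun x => φ x ^ 2 / ‖x‖ ^ 2) (dens μ) ∧
      (c₀μ μ).toReal * ∫ x, φ x ^ 2 / ‖x‖ ^ 2 ∂(dens μ) ≤
        ∫ x, ‖F x‖ ^ 2 ∂(dens μ) + C * ∫ x, φ x ^ 2 ∂(dens μ) := by
  have h0 := hμ.nonneg
  obtain ⟨hm, b, hb, hb0, hB⟩ := exists_weakGradient_bound h0 hμ.sqrt_mem
  have hD := (hasWeakLaplacian_weakLaplacian hμ.laplacian).hasWeakDiv hm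
  have mμ : AEMeasurable μ := hm.1.aestronglyMeasurable.aemeasurable
  obtain ⟨C, hC0, hC⟩ := exists_potential_bound hN hμ mμ hc.le
  refine ⟨C, fun φ₀ F₀ h₀ => ?_⟩
  -- Membership in `L²_μ` says nothing on the set where `μ = 0`. Measurable representatives are
  -- chosen so that the Lebesgue integrals below make sense; no term of the inequality changes.
  have eφ := h₀.memLp.1.ae_eq_mk
  have eF := h₀.memLp_grad.1.ae_eq_mk
  have mφ := h₀.memLp.1.stronglyMeasurable_mk.measurable.aemeasurable (μ := volume)
  have mF := h₀.memLp_grad.1.stronglyMeasurable_mk.measurable.aemeasurable (μ := volume)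
  have h := h₀.congr eφ eF
  set φ := h₀.memLp.1.mk φ₀
  set F := h₀.memLp_grad.1.mk F₀
  have iφ : Integrable fun x => μ x * φ x ^ 2 := by
    have := (integrable_dens_iff mμ h0).1 ((memLp_two_iff_integrable_sq_norm h.memLp.1).1 h.memLp)
    simpa using this
  have iF : Integrable fun x => μ x * ‖F x‖ ^ 2 :=
    (integrable_dens_iff mμ h0).1
      ((memLp_two_iff_integrable_sq_norm h.memLp_grad.1).1 h.memLp_grad)
  have hw := h.hasWeakGradient h0 hm hb hb0 hB mφ mF iφ iF
  obtain ⟨h1, h2⟩ := hardy_of_potential_le hN hm hD h0 hb hb0 hB hw mφ mF iφ iF hc.le hC0 hC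
  have e1 : (fun x => φ₀ x ^ 2 / ‖x‖ ^ 2) =ᵐ[dens μ] fun x => φ x ^ 2 / ‖x‖ ^ 2 := by
    filter_upwards [eφ] with x hx
    rw [hx]
  have e2 : ∫ x, ‖F₀ x‖ ^ 2 ∂(dens μ) = ∫ x, ‖F x‖ ^ 2 ∂(dens μ) :=
    integral_congr_ae (by filter_upwards [eF] with x hx; rw [hx])
  have e3 : ∫ x, φ₀ x ^ 2 ∂(dens μ) = ∫ x, φ x ^ 2 ∂(dens μ) :=
    integral_congr_ae (by filter_upwards [eφ] with x hx; rw [hx])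
  have e4 (x : Rn N) : μ x * (φ x ^ 2 * ((c₀μ μ).toReal / ‖x‖ ^ 2))
      = (c₀μ μ).toReal * (μ x • (φ x ^ 2 / ‖x‖ ^ 2)) := by
    rw [smul_eq_mul]; ring
  simp only [e4] at h1 h2
  rw [integrable_congr e1, integral_congr_ae e1, e2, e3, integrable_dens_iff mμ h0,
    integral_dens mμ h0, integral_dens mμ h0, integral_dens mμ h0]
  refine ⟨?_, ?_⟩
  · refine (h1.const_mul (c₀μ μ).toReal⁻¹).congr (Eventually.of_forall fun x => ?_)
    dsimp only
    rw [inv_mul_cancel_left₀ hc.ne']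
  · rw [integral_const_mul] at h2
    exact h2

end Sobolev

end WeightedHardy

theorem mainTheorem5 (N : ℕ) (hN : 2 ≤ N) (μ : WeightedHardy.Rn N → ℝ)
    (hμ : WeightedHardy.HypH2 μ) :
    ∃ C : ℝ, ∀ (φ : WeightedHardy.Rn N → ℝ) (F : WeightedHardy.Rn N → WeightedHardy.Rn N),
      WeightedHardy.MemH1μ μ φ F →
        (0 < WeightedHardy.c₀μ μ →
          MeasureTheory.Integrable (fun x => φ x ^ 2 / ‖x‖ ^ 2) (WeightedHardy.dens μ)) ∧
        (WeightedHardy.c₀μ μ).toReal * ∫ x, φ x ^ 2 / ‖x‖ ^ 2 ∂(WeightedHardy.dens μ) ≤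
          ∫ x, ‖F x‖ ^ 2 ∂(WeightedHardy.dens μ) +
            C * ∫ x, φ x ^ 2 ∂(WeightedHardy.dens μ) := by
  have hc : ((WeightedHardy.c₀μ μ).toReal : EReal) = WeightedHardy.c₀μ μ :=
    EReal.coe_toReal hμ.finite.2 hμ.finite.1
  rcases lt_or_ge 0 (WeightedHardy.c₀μ μ).toReal with h | h
  · obtain ⟨C, hC⟩ := hμ.exists_hardy hN h
    exact ⟨C, fun φ F hφ => ⟨fun _ => (hC φ F hφ).1, (hC φ F hφ).2⟩⟩
  -- For `c_{0,μ} ≤ 0` the left side is nonpositive, also when `φ² / |x|²` is not integrable and its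
  -- integral takes the default value `0`.
  · refine ⟨0, fun φ F _ => ⟨fun h' => ?_, ?_⟩⟩
    · rw [← hc, EReal.coe_pos] at h'
      exact absurd h' (not_lt.2 h)
    · have h1 : 0 ≤ ∫ x, φ x ^ 2 / ‖x‖ ^ 2 ∂(WeightedHardy.dens μ) :=
        integral_nonneg fun x => by positivity
      have h2 : 0 ≤ ∫ x, ‖F x‖ ^ 2 ∂(WeightedHardy.dens μ) :=
        integral_nonneg fun x => by positivity
      rw [zero_mul, add_zero]
      exact (mul_nonpos_of_nonpos_of_nonneg h h1).trans h2
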